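/- A conjugacy class $C$ of a finite group $G$ is a sign conjugacy class if every irreducible complex character of $G$ takes only the values $0$, $1$, $-1$ on $C$. A partition $\gamma$ of $n$ is an $A_n$-sign partition if it is the cycle partition (fixed points counted as parts equal to $1$) of a sign conjugacy class of the alternating group $A_n$. Let $\gamma$ be an $A_n$-sign partition with $\gamma\notin\{(1,1,1),(2,2),(2,2,1)\}$. Then no part of $\gamma$ other than $1$ occurs more than once, and the part $1$ occurs at most twice. -/

import Mathlib

/-- `χ` is the character of an irreducible complex representation of the finite group `G`.
Every finite-dimensional complex space is isomorphic to one in `Type`, so no irreducible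
character is lost by letting `V` range over `Type`. -/
def IsIrreducibleCharacter {G : Type} [Group G] [Finite G] (χ : G → ℂ) : Prop :=
  ∃ (V : Type) (_ : AddCommGroup V) (_ : Module ℂ V) (_ : FiniteDimensional ℂ V)
    (ρ : Representation ℂ G V), ρ.IsIrreducible ∧ ρ.character = χ

/-- A conjugacy class `C` of the finite group `G` is a sign conjugacy class if every irreducible
character of `G` only takes the values `0`, `1`, `-1` on `C`. -/
def IsSignConjClass {G : Type} [Group G] [Finite G] (C : ConjClasses G) : Prop :=
  ∀ χ : G → ℂ, IsIrreducibleCharacter χ → ∀ g ∈ C.carrier, χ g = 0 ∨ χ g = 1 ∨ χ g = -1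

/-- The partition `γ` of `n` is an `A_n`-sign partition if it is the cycle partition (fixed points
counted as parts `1`) of the elements of some sign conjugacy class of the alternating group `A_n`.
Such a `γ` is automatically an even partition. -/
def IsAlternatingSignPartition {n : ℕ} (γ : n.Partition) : Prop :=
  ∃ C : ConjClasses (alternatingGroup (Fin n)), IsSignConjClass C ∧
    ∃ g ∈ C.carrier, (g : Equiv.Perm (Fin n)).partition.parts = γ.parts

/-! ### Complete reducibility and virtual characters -/

open Representation Module

/-! On a sign class irreducible characters have absolute value at most 1, so a virtual character ψ =
Σ m_χ χ satisfies |ψ(g)| ≤ Σ |m_χ| ≤ Σ m_χ² = ⟨ψ, ψ⟩ there (`IsSignConjClass.abs_le_charForm`).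
Every step tests g against a virtual character whose norm is small compared with its value.

Let π_j be the permutation character on j-subsets. Counting orbits on pairs of subsets shows that
π_{j+1} − π_j has norm at most 1, so g fixes at most one more (j+1)-subset than j-subsets. For j = 0
this leaves at most two fixed points. For j + 1 = k, the smallest nontrivial cycle length, it shows
that k occurs only once unless fixed points interfere; then k = 2 needs the character of the hook (n
− 2, 1, 1), and k = 3 needs a comparison of 3-subsets with 4-subsets.

Now let the shortest length l occur once and some longer k be repeated. Write g = u₀v, with u₀
supported on a block B made of the l-cycle and, if there is one, a single fixed point. Let w arise
from v by merging two k-cycles into a 2k-cycle. Some 2-power of v is conjugate to the same power of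
w, and integral characters satisfy χ(x²) ≡ χ(x) mod 2, so every character of Sym(Bᶜ) takes congruent
values at v and w. Hence half the difference of the class functions attached to v and w, averaged
over Sym(B), is a virtual character of S_n (`blockFunction_mem_virtualCharacters`), which is then
restricted to A_n. Its value at g comes from the centralizer of v alone, while its norm involves the
centralizers of both v and w. The norm bound becomes k(c+1)(c+2)b ≤ 2(d+1)(b+2q)
(`IsSignConjClass.block_inequality`), where b = |B| and c, d, q count the remaining cycles of v of
lengths k, 2k and b. This fails if k is chosen with fewer cycles of length 2k than of length k. -/

theorem Representation.induction_of_isCompl {G : Type} [Group G] [Finite G]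
    {P : ∀ (V : Type) [AddCommGroup V] [Module ℂ V], Representation ℂ G V → Prop}
    (subsingleton : ∀ (V : Type) [AddCommGroup V] [Module ℂ V] (ρ : Representation ℂ G V),
      Subsingleton V → P V ρ)
    (irreducible : ∀ (V : Type) [AddCommGroup V] [Module ℂ V] [FiniteDimensional ℂ V]
      (ρ : Representation ℂ G V), ρ.IsIrreducible → P V ρ)
    (isCompl : ∀ (V : Type) [AddCommGroup V] [Module ℂ V] [FiniteDimensional ℂ V]
      (ρ : Representation ℂ G V) (W W' : Subrepresentation ρ), IsCompl W W' →
      P W.toSubmodule W.toRepresentation → P W'.toSubmodule W'.toRepresentation → P V ρ)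
    (V : Type) [AddCommGroup V] [Module ℂ V] [FiniteDimensional ℂ V] (ρ : Representation ℂ G V) :
    P V ρ := by
  induction hn : finrank ℂ V using Nat.strong_induction_on generalizing V with
  | _ n ih =>
    rcases subsingleton_or_nontrivial V with hV | hV
    · exact subsingleton V ρ hV
    by_cases hirr : ρ.IsIrreducible
    · exact irreducible V ρ hirr
    have hbt : (⊥ : Subrepresentation ρ) ≠ ⊤ := fun h => by
      have : (⊥ : Submodule ℂ V) = ⊤ := congrArg Subrepresentation.toSubmodule h
      exact bot_ne_top this
    have hW : ∃ W : Subrepresentation ρ, W ≠ ⊥ ∧ W ≠ ⊤ := by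
      by_contra! h
      refine hirr { exists_pair_ne := ⟨_, _, hbt⟩, eq_bot_or_eq_top := fun W => ?_ }
      by_cases hW : W = ⊥
      · exact Or.inl hW
      · exact Or.inr (h W hW)
    obtain ⟨W, hWb, hWt⟩ := hW
    have : NeZero (Nat.card G : ℂ) := ⟨Nat.cast_ne_zero.mpr Nat.card_pos.ne'⟩
    obtain ⟨W', hc⟩ := exists_isCompl W
    have hW't : W' ≠ ⊤ := by
      rintro rfl
      exact hWb (by simpa using hc.inf_eq_bot)
    have hlt : ∀ U : Subrepresentation ρ, U ≠ ⊤ → finrank ℂ U.toSubmodule < n := by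
      intro U hU
      rw [← hn]
      exact Submodule.finrank_lt fun h => hU (Subrepresentation.toSubmodule_injective h)
    exact isCompl V ρ W W' hc (ih _ (hlt W hWt) _ _ rfl) (ih _ (hlt W' hW't) _ _ rfl)

theorem Subrepresentation.isCompl_toSubmodule {G V : Type} [Group G] [AddCommGroup V] [Module ℂ V]
    {ρ : Representation ℂ G V} {W W' : Subrepresentation ρ} (h : IsCompl W W') :
    IsCompl W.toSubmodule W'.toSubmodule := by
  constructor
  · rw [disjoint_iff, ← Subrepresentation.toSubmodule_inf, h.inf_eq_bot]; rfl
  · rw [codisjoint_iff, ← Subrepresentation.toSubmodule_sup, h.sup_eq_top]; rfl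

theorem Representation.character_eq_add_of_isCompl {G V : Type} [Group G] [AddCommGroup V]
    [Module ℂ V] [FiniteDimensional ℂ V] {ρ : Representation ℂ G V} {W W' : Subrepresentation ρ}
    (h : IsCompl W W') :
    ρ.character = W.toRepresentation.character + W'.toRepresentation.character := by
  ext g
  let e := Submodule.prodEquivOfIsCompl _ _ (Subrepresentation.isCompl_toSubmodule h)
  have : ρ g = e.conj ((W.toRepresentation g).prodMap (W'.toRepresentation g)) := by
    ext v
    obtain ⟨w, rfl⟩ := e.surjective v
    simp [LinearEquiv.conj_apply, e, Subrepresentation.toRepresentation]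
  simp only [character, Pi.add_apply]
  rw [this, LinearMap.trace_conj', LinearMap.trace_prodMap']

/-- The `ℤ`-module of virtual characters of a finite group. -/
noncomputable def virtualCharacters (G : Type) [Group G] [Finite G] : Submodule ℤ (G → ℂ) :=
  Submodule.span ℤ {χ | IsIrreducibleCharacter χ}

theorem Representation.character_mem_virtualCharacters {G : Type} [Group G] [Finite G]
    (V : Type) [AddCommGroup V] [Module ℂ V] [FiniteDimensional ℂ V] (ρ : Representation ℂ G V) :
    ρ.character ∈ virtualCharacters G := by
  refine Representation.induction_of_isCompl (G := G)
    (P := fun V _ _ ρ => ρ.character ∈ virtualCharacters G) ?_ ?_ ?_ V ρ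
  · intro V _ _ ρ hV
    have : ρ.character = 0 := by
      ext g
      have : ρ g = 0 := Subsingleton.elim _ _
      simp [character, this]
    rw [this]
    exact zero_mem _
  · intro V _ _ _ ρ h
    exact Submodule.subset_span ⟨V, _, _, inferInstance, ρ, h, rfl⟩
  · intro V _ _ _ ρ W W' h h1 h2
    rw [character_eq_add_of_isCompl h]
    exact add_mem h1 h2

/-! ### Orthonormality, completeness and the norm bound -/

section Form

variable {G : Type} [Group G] [Fintype G]

/-- The bilinear form `(1 / |G|) ∑ f(x) h(x⁻¹)` on functions on `G`. -/
noncomputable def charForm (f h : G → ℂ) : ℂ :=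
  (Nat.card G : ℂ)⁻¹ * ∑ g, f g * h g⁻¹

theorem charForm_add_left (f f' h : G → ℂ) :
    charForm (f + f') h = charForm f h + charForm f' h := by
  simp [charForm, add_mul, Finset.sum_add_distrib, mul_add]

theorem charForm_smul_left (c : ℂ) (f h : G → ℂ) : charForm (c • f) h = c * charForm f h := by
  simp [charForm, mul_assoc, Finset.mul_sum, mul_left_comm]

theorem charForm_comm (f h : G → ℂ) : charForm f h = charForm h f := by
  simp only [charForm]
  congr 1
  exact Fintype.sum_equiv (Equiv.inv G) _ _ fun g => by simp [mul_comm]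

theorem charForm_sum_left {ι : Type*} (s : Finset ι) (f : ι → G → ℂ) (h : G → ℂ) :
    charForm (∑ i ∈ s, f i) h = ∑ i ∈ s, charForm (f i) h := by
  classical
  induction s using Finset.induction_on with
  | empty => simp [charForm]
  | insert a s ha ih => rw [Finset.sum_insert ha, Finset.sum_insert ha, charForm_add_left, ih]

theorem charForm_sum_right {ι : Type*} (s : Finset ι) (f : ι → G → ℂ) (h : G → ℂ) :
    charForm h (∑ i ∈ s, f i) = ∑ i ∈ s, charForm h (f i) := by
  simp_rw [charForm_comm h, charForm_sum_left]

theorem charForm_smul_right (c : ℂ) (f h : G → ℂ) : charForm f (c • h) = c * charForm f h := by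
  rw [charForm_comm, charForm_smul_left, charForm_comm]

theorem charForm_sub_left (f f' h : G → ℂ) :
    charForm (f - f') h = charForm f h - charForm f' h := by
  rw [sub_eq_add_neg, ← neg_one_smul ℂ, charForm_add_left, charForm_smul_left]
  ring

theorem charForm_add_right (f f' h : G → ℂ) :
    charForm h (f + f') = charForm h f + charForm h f' := by
  simp_rw [charForm_comm h, charForm_add_left]

theorem charForm_sub_right (f f' h : G → ℂ) :
    charForm h (f - f') = charForm h f - charForm h f' := by
  simp_rw [charForm_comm h, charForm_sub_left]

open Classical in
theorem IsIrreducibleCharacter.charForm_eq {χ χ' : G → ℂ} (h : IsIrreducibleCharacter χ)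
    (h' : IsIrreducibleCharacter χ') : charForm χ χ' = if χ = χ' then 1 else 0 := by
  obtain ⟨V, _, _, _, ρ, hρ, rfl⟩ := h
  obtain ⟨W, _, _, _, σ, hσ, rfl⟩ := h'
  have : Invertible (Nat.card G : ℂ) := invertibleOfNonzero (Nat.cast_ne_zero.mpr Nat.card_pos.ne')
  have key := char_orthonormal ρ σ
  have key' := char_orthonormal ρ ρ
  rw [if_pos ⟨Representation.Equiv.refl ρ⟩] at key'
  unfold charForm
  by_cases hne : Nonempty (σ.Equiv ρ)
  · rw [key, if_pos hne, if_pos]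
    obtain ⟨φ⟩ := hne
    exact (char_iso φ).symm
  · rw [key, if_neg hne, if_neg]
    intro heq
    rw [if_neg hne, ← heq, key'] at key
    exact one_ne_zero key

theorem exists_sum_of_mem_virtualCharacters {ψ : G → ℂ} (h : ψ ∈ virtualCharacters G) :
    ∃ (s : Finset (G → ℂ)) (m : (G → ℂ) → ℤ), (∀ χ ∈ s, IsIrreducibleCharacter χ) ∧
      ψ = ∑ χ ∈ s, (m χ : ℂ) • χ := by
  obtain ⟨c, hc, rfl⟩ := Submodule.mem_span_set.mp h
  refine ⟨c.support, c, fun χ hχ => hc hχ, ?_⟩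
  rw [Finsupp.sum]
  refine Finset.sum_congr rfl fun χ _ => ?_
  ext g
  simp

theorem charForm_sum_irreducible {s : Finset (G → ℂ)} (hs : ∀ χ ∈ s, IsIrreducibleCharacter χ)
    (m : (G → ℂ) → ℂ) {χ : G → ℂ} (hχ : χ ∈ s) : charForm (∑ χ ∈ s, m χ • χ) χ = m χ := by
  classical
  rw [charForm_sum_left, Finset.sum_eq_single χ]
  · rw [charForm_smul_left, (hs χ hχ).charForm_eq (hs χ hχ), if_pos rfl, mul_one]
  · intro b hb hne
    rw [charForm_smul_left, (hs b hb).charForm_eq (hs χ hχ), if_neg hne, mul_zero]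
  · exact fun h => absurd hχ h

/-- On a sign conjugacy class the absolute value of a virtual character is at most its norm. -/
theorem IsSignConjClass.abs_le_charForm {C : ConjClasses G} (hC : IsSignConjClass C) {g : G}
    (hg : g ∈ C.carrier) {ψ : G → ℂ} (hψ : ψ ∈ virtualCharacters G) :
    ∃ a b : ℤ, ψ g = a ∧ charForm ψ ψ = b ∧ |a| ≤ b := by
  obtain ⟨s, m, hs, rfl⟩ := exists_sum_of_mem_virtualCharacters hψ
  have hval : ∀ χ ∈ s, ∃ ε : ℤ, χ g = ε ∧ |ε| ≤ 1 := by
    intro χ hχ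
    rcases hC χ (hs χ hχ) g hg with h | h | h
    · exact ⟨0, by simpa using h, by simp⟩
    · exact ⟨1, by simpa using h, by simp⟩
    · exact ⟨-1, by simpa using h, by simp⟩
  choose! ε hε hε1 using hval
  refine ⟨∑ χ ∈ s, m χ * ε χ, ∑ χ ∈ s, m χ * m χ, ?_, ?_, ?_⟩
  · push_cast
    rw [Finset.sum_apply]
    exact Finset.sum_congr rfl fun χ hχ => by simp [hε χ hχ]
  · push_cast
    rw [charForm_sum_right]
    refine Finset.sum_congr rfl fun χ hχ => ?_
    rw [charForm_smul_right, charForm_sum_irreducible hs (fun χ => (m χ : ℂ)) hχ]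
  -- Integrality of the multiplicities enters here: |m| ≤ m².
  · refine (Finset.abs_sum_le_sum_abs _ _).trans (Finset.sum_le_sum fun χ hχ => ?_)
    rw [abs_mul, ← abs_mul_abs_self (m χ)]
    have h1 := hε1 χ hχ
    rcases (abs_nonneg (m χ)).eq_or_lt with h0 | h0
    · simp [← h0]
    · have := abs_nonneg (ε χ)
      nlinarith

/-- Orthonormal functions are linearly independent in a finite-dimensional space. -/
theorem finite_irreducibleCharacters (G : Type) [Group G] [Fintype G] :
    {χ : G → ℂ | IsIrreducibleCharacter χ}.Finite := by
  classical
  refine LinearIndependent.setFinite (R := ℂ) ?_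
  rw [linearIndependent_iff']
  intro s c hc χ hχ
  have := congrArg (fun f => charForm f (χ : G → ℂ)) hc
  simp only [charForm_sum_left, charForm_smul_left] at this
  rw [Finset.sum_eq_single χ] at this
  · rw [χ.2.charForm_eq χ.2, if_pos rfl, mul_one] at this
    rw [this]
    simp [charForm]
  · intro b _ hb
    rw [b.2.charForm_eq χ.2, if_neg (fun h => hb (Subtype.ext h)), mul_zero]
  · exact fun h => absurd hχ h

/-- The operator `∑ F(x) ρ(x⁻¹)`. -/
noncomputable def Representation.classSum {V : Type} [AddCommGroup V] [Module ℂ V]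
    (ρ : Representation ℂ G V) (F : G → ℂ) : V →ₗ[ℂ] V := ∑ x, F x • ρ x⁻¹

theorem Representation.classSum_commute {V : Type} [AddCommGroup V] [Module ℂ V]
    (ρ : Representation ℂ G V) {F : G → ℂ} (hF : ∀ a x, F (a * x * a⁻¹) = F x) (g : G) :
    ρ.classSum F ∘ₗ ρ g = ρ g ∘ₗ ρ.classSum F := by
  have h1 : ρ.classSum F * ρ g = ρ g * ρ.classSum F := by
    simp only [classSum, Finset.sum_mul, Finset.mul_sum, smul_mul_assoc, mul_smul_comm, ← map_mul]
    refine Fintype.sum_equiv (MulAut.conj g⁻¹).toEquiv _ _ fun x => ?_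
    have := hF g⁻¹ x
    simp only [inv_inv] at this
    simp only [mul_assoc] at this
    simp [this, mul_assoc]
  exact h1

/-- By Schur's lemma the operator is scalar on an irreducible representation, and orthogonality
makes its trace zero. Complete reducibility does the rest. -/
theorem Representation.classSum_eq_zero {F : G → ℂ} (hF : ∀ a x, F (a * x * a⁻¹) = F x)
    (horth : ∀ χ, IsIrreducibleCharacter χ → charForm F χ = 0)
    (V : Type) [AddCommGroup V] [Module ℂ V] [FiniteDimensional ℂ V] (ρ : Representation ℂ G V) :
    ρ.classSum F = 0 := by
  refine Representation.induction_of_isCompl (G := G)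
    (P := fun V _ _ ρ => ρ.classSum F = 0) ?_ ?_ ?_ V ρ
  · intro V _ _ ρ hV
    exact Subsingleton.elim _ _
  · intro V _ _ _ ρ h
    obtain ⟨c, hc⟩ := IsIrreducible.algebraMap_intertwiningMap_bijective_of_isAlgClosed.2
      (⟨ρ.classSum F, ρ.classSum_commute hF⟩ : IntertwiningMap ρ ρ)
    have hc' : ρ.classSum F = c • LinearMap.id := by
      have := congrArg IntertwiningMap.toLinearMap hc
      refine Eq.trans this.symm ?_
      ext v
      simp [Algebra.algebraMap_eq_smul_one]
    have htr : LinearMap.trace ℂ V (ρ.classSum F) = 0 := by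
      have h0 := horth ρ.character ⟨V, _, _, inferInstance, ρ, h, rfl⟩
      rw [charForm, mul_eq_zero] at h0
      have h1 := h0.resolve_left (inv_ne_zero (Nat.cast_ne_zero.mpr Nat.card_pos.ne'))
      rw [classSum, map_sum, ← h1]
      exact Finset.sum_congr rfl fun x _ => by simp [character]
    have hV : Nontrivial V := by
      by_contra hV
      rw [not_nontrivial_iff_subsingleton] at hV
      obtain ⟨a, b, hab⟩ := h.toNontrivial
      exact hab (Subrepresentation.toSubmodule_injective (Subsingleton.elim _ _))
    rw [hc', map_smul, LinearMap.trace_id, smul_eq_mul, mul_eq_zero] at htr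
    have hc0 : c = 0 := htr.resolve_right (Nat.cast_ne_zero.mpr finrank_pos.ne')
    rw [hc', hc0, zero_smul]
  · intro V _ _ _ ρ W W' h h1 h2
    have hcompl := Subrepresentation.isCompl_toSubmodule h
    have hz : ∀ U : Subrepresentation ρ, U.toRepresentation.classSum F = 0 →
        ∀ v ∈ U.toSubmodule, ρ.classSum F v = 0 := by
      intro U hU v hv
      have := congrArg Subtype.val (LinearMap.congr_fun hU ⟨v, hv⟩)
      simpa [classSum, LinearMap.sum_apply, Subrepresentation.toRepresentation] using this
    ext v
    have hv : v ∈ W.toSubmodule ⊔ W'.toSubmodule := by rw [hcompl.sup_eq_top]; trivial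
    obtain ⟨w, hw, w', hw', rfl⟩ := Submodule.mem_sup.mp hv
    rw [map_add, hz W h1 w hw, hz W' h2 w' hw']
    simp

/-- In the regular representation the operator sends the identity element to Σ F(x) x⁻¹, which
displays all values of F. -/
theorem eq_zero_of_forall_charForm_eq_zero {F : G → ℂ} (hF : ∀ a x, F (a * x * a⁻¹) = F x)
    (horth : ∀ χ, IsIrreducibleCharacter χ → charForm F χ = 0) : F = 0 := by
  classical
  have h := Representation.classSum_eq_zero hF horth _ (leftRegular ℂ G)
  have h1 := LinearMap.congr_fun h (MonoidAlgebra.single 1 1)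
  ext g
  have h2 := congrArg (fun v : MonoidAlgebra ℂ G => v.coeff g⁻¹) h1
  simpa [classSum, LinearMap.sum_apply, MonoidAlgebra.coeff_single, Finsupp.single_apply,
    inv_inj] using h2

/-- A class function with integral multiplicities is a virtual character. -/
theorem mem_virtualCharacters_of_charForm {F : G → ℂ} (hF : ∀ a x, F (a * x * a⁻¹) = F x)
    (hint : ∀ χ, IsIrreducibleCharacter χ → ∃ m : ℤ, charForm F χ = m) :
    F ∈ virtualCharacters G := by
  choose! m hm using hint
  set s := (finite_irreducibleCharacters G).toFinset with hs
  have hs' : ∀ χ ∈ s, IsIrreducibleCharacter χ := fun χ hχ => by simpa [hs] using hχ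
  have hclass : ∀ χ : G → ℂ, IsIrreducibleCharacter χ → ∀ a x, χ (a * x * a⁻¹) = χ x := by
    rintro χ ⟨V, _, _, _, ρ, -, rfl⟩ a x
    exact char_conj ρ x a
  -- F minus its expected expansion is a class function orthogonal to every irreducible character.
  have key : F + (-1 : ℂ) • ∑ χ ∈ s, (m χ : ℂ) • χ = 0 := by
    refine eq_zero_of_forall_charForm_eq_zero ?_ ?_
    · intro a x
      simp only [Pi.add_apply, Pi.smul_apply, Finset.sum_apply, hF]
      congr 2
      exact Finset.sum_congr rfl fun χ hχ => by rw [hclass χ (hs' χ hχ)]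
    · intro χ hχ
      rw [charForm_add_left, charForm_smul_left, charForm_sum_irreducible hs'
        (fun χ => (m χ : ℂ)) (by simpa [hs] using hχ), hm χ hχ]
      ring
  have hF' : F = ∑ χ ∈ s, m χ • χ := by
    have := eq_neg_of_add_eq_zero_left key
    rw [this]
    ext x
    simp
  rw [hF']
  exact Submodule.sum_mem _ fun χ hχ =>
    Submodule.smul_mem _ _ (Submodule.subset_span (hs' χ hχ))

end Form

/-! ### Permutation characters and orbit counting -/

section PermutationCharacter

/-- The character of the permutation representation on `X`. -/
noncomputable def permCharacter (G X : Type) [Group G] [MulAction G X] : G → ℂ :=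
  fun g => Nat.card (MulAction.fixedBy X g)

theorem permCharacter_mem_virtualCharacters (G X : Type) [Group G] [Finite G] [MulAction G X]
    [Finite X] : permCharacter G X ∈ virtualCharacters G := by
  classical
  have := Fintype.ofFinite X
  let b : Basis X ℂ (MonoidAlgebra ℂ X) := ⟨MonoidAlgebra.coeffLinearEquiv ℂ⟩
  have : FiniteDimensional ℂ (MonoidAlgebra ℂ X) := b.finiteDimensional_of_finite
  have h := Representation.character_mem_virtualCharacters _ (ofMulAction ℂ G X)
  convert! h
  ext g
  have hb : ∀ x, b x = MonoidAlgebra.single x 1 := fun x => rfl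
  have hr : ∀ v x, b.repr v x = v.coeff x := fun v x => rfl
  rw [character, LinearMap.trace_eq_matrix_trace ℂ b, Matrix.trace]
  simp only [Matrix.diag_apply, LinearMap.toMatrix_apply, hb, hr, ofMulAction_single,
    MonoidAlgebra.coeff_single, Finsupp.single_apply]
  rw [Finset.sum_boole, permCharacter, Nat.card_eq_fintype_card, Fintype.card_subtype]
  rfl

/-- The product of the two characters counts fixed points on X × Y, so this is Burnside's lemma. -/
theorem charForm_permCharacter (G X Y : Type) [Group G] [Fintype G] [MulAction G X] [MulAction G Y]
    [Finite X] [Finite Y] : charForm (permCharacter G X) (permCharacter G Y) =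
      Nat.card (MulAction.orbitRel.Quotient G (X × Y)) := by
  classical
  have := Fintype.ofFinite X
  have := Fintype.ofFinite Y
  have hB := MulAction.sum_card_fixedBy_eq_card_orbits_mul_card_group G (X × Y)
  have hG : (Nat.card G : ℂ) ≠ 0 := Nat.cast_ne_zero.mpr Nat.card_pos.ne'
  rw [charForm, inv_mul_eq_iff_eq_mul₀ hG, mul_comm, Nat.card_eq_fintype_card (α := G),
    Nat.card_eq_fintype_card, ← Nat.cast_mul]
  refine Eq.trans ?_ (congrArg (Nat.cast : ℕ → ℂ) hB)
  push_cast
  refine Finset.sum_congr rfl fun g _ => ?_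
  rw [permCharacter, permCharacter, ← Nat.cast_mul, ← Nat.card_prod, Nat.cast_inj,
    Nat.card_eq_fintype_card]
  refine Fintype.card_congr ⟨fun p => ⟨(p.1.1, p.2.1), ?_⟩, fun p => (⟨p.1.1, ?_⟩, ⟨p.1.2, ?_⟩),
    fun _ => rfl, fun _ => rfl⟩
  · have h1 : g • p.1.1 = p.1.1 := p.1.2
    have h2 : g⁻¹ • p.2.1 = p.2.1 := p.2.2
    exact Prod.ext h1 (inv_smul_eq_iff.mp h2).symm
  · exact congrArg Prod.fst p.2
  · exact inv_smul_eq_iff.mpr (congrArg Prod.snd p.2).symm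

/-- An upper bound needs only a labelling that separates orbits, and the lower bound below only an
invariant one. Norm estimates use upper bounds for the positive terms and lower bounds for the
negative ones. -/
theorem card_orbits_le {G X T : Type} [Group G] [MulAction G X] (c : X → T)
    (S : Finset T) (hS : ∀ x, c x ∈ S) (hc : ∀ x y, c x = c y → ∃ g : G, g • x = y) :
    Nat.card (MulAction.orbitRel.Quotient G X) ≤ S.card := by
  have hinj : Function.Injective
      (fun q : MulAction.orbitRel.Quotient G X => (⟨c q.out, hS _⟩ : S)) := by
    intro p q h
    obtain ⟨g, hg⟩ := hc _ _ (congrArg Subtype.val h)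
    rw [← Quotient.out_eq p, ← Quotient.out_eq q]
    exact (Quotient.sound (s := MulAction.orbitRel G X) ⟨g, hg⟩).symm
  simpa using Nat.card_le_card_of_injective _ hinj

theorem le_card_orbits {G X T : Type} [Group G] [MulAction G X] [Finite X] (c : X → T)
    (hc : ∀ (g : G) x, c (g • x) = c x) (S : Finset T) (hS : ∀ t ∈ S, ∃ x, c x = t) :
    S.card ≤ Nat.card (MulAction.orbitRel.Quotient G X) := by
  choose x hx using fun t : S => hS t t.2
  have hinj : Function.Injective
      (fun t : S => (Quotient.mk _ (x t) : MulAction.orbitRel.Quotient G X)) := by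
    intro t u h
    obtain ⟨g, hg⟩ := Quotient.exact (s := MulAction.orbitRel G X) h
    have : c (g • x u) = c (x t) := congrArg c hg
    rw [hc, hx, hx] at this
    exact (Subtype.ext this).symm
  simpa using Nat.card_le_card_of_injective _ hinj

end PermutationCharacter

/-! ### Moving configurations by even permutations -/

section Transitivity

open Equiv

variable {α : Type} [Fintype α] [DecidableEq α]

/-- A transposition that preserves the required property corrects the parity. -/
theorem exists_mem_alternatingGroup_of_swap {P : Perm α → Prop} {σ : Perm α} (hσ : P σ)
    {a b : α} (hab : a ≠ b) (hP : P (swap a b * σ)) : ∃ τ : alternatingGroup α, P τ := by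
  rcases Int.units_eq_one_or (Perm.sign σ) with h | h
  · exact ⟨⟨σ, h⟩, hσ⟩
  · refine ⟨⟨swap a b * σ, ?_⟩, hP⟩
    rw [Perm.mem_alternatingGroup, Perm.sign_mul, Perm.sign_swap hab, h]
    rfl

/-- Matching the fibres gives some permutation; swapping two points of equal colour repairs its
sign. -/
theorem exists_alternating_of_card_fiber {T : Type} [DecidableEq T] {c c' : α → T}
    (h : ∀ t, Fintype.card {x // c x = t} = Fintype.card {x // c' x = t})
    (h2 : ∃ a b, a ≠ b ∧ c' a = c' b) :
    ∃ τ : alternatingGroup α, ∀ x, c' ((τ : Perm α) x) = c x := by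
  let e : ∀ t, {x // c x = t} ≃ {x // c' x = t} := fun t => Fintype.equivOfCardEq (h t)
  let σ : Perm α := (Equiv.sigmaFiberEquiv c).symm.trans
    ((Equiv.sigmaCongrRight e).trans (Equiv.sigmaFiberEquiv c'))
  have hσ : ∀ x, c' (σ x) = c x := fun x => (e (c x) ⟨x, rfl⟩).2
  obtain ⟨a, b, hab, hc⟩ := h2
  refine exists_mem_alternatingGroup_of_swap (P := fun τ => ∀ x, c' (τ x) = c x) hσ hab ?_
  intro x
  rw [Perm.mul_apply, ← hσ x]
  rcases eq_or_ne (σ x) a with h | h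
  · rw [h, swap_apply_left, hc]
  rcases eq_or_ne (σ x) b with h' | h'
  · rw [h', swap_apply_right, hc]
  · rw [swap_apply_of_ne_of_ne h h']

/-- The tuple `t'` takes at most m values, so two points outside it are free for the parity
correction. -/
theorem exists_alternating_of_ker_eq {m : ℕ} (hm : m + 2 ≤ Fintype.card α) {t t' : Fin m → α}
    (h : ∀ i j, t i = t j ↔ t' i = t' j) :
    ∃ τ : alternatingGroup α, ∀ i, (τ : Perm α) (t i) = t' i := by
  classical
  have hk : Setoid.ker t = Setoid.ker t' := by
    ext i j
    exact h i j
  let e : Set.range t ≃ Set.range t' := (Setoid.quotientKerEquivRange t).symm.trans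
    ((Quotient.congrRight fun i j => by rw [hk]).trans (Setoid.quotientKerEquivRange t'))
  have he : ∀ i, (e ⟨t i, i, rfl⟩ : α) = t' i := by
    intro i
    have : (Setoid.quotientKerEquivRange t).symm ⟨t i, i, rfl⟩ = Quotient.mk _ i := by
      rw [Equiv.symm_apply_eq]
      rfl
    simp only [e, Equiv.trans_apply, this]
    rfl
  let σ : Perm α := Equiv.extendSubtype (p := (· ∈ Set.range t)) (q := (· ∈ Set.range t')) e
  have hσ : ∀ i, σ (t i) = t' i := fun i => by
    rw [← he i]
    exact Equiv.extendSubtype_apply_of_mem _ _ _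
  have hcard : 1 < ((Finset.univ.image t')ᶜ).card := by
    have h1 : (Finset.univ.image t').card ≤ m := by
      simpa using Finset.card_image_le (s := Finset.univ) (f := t')
    rw [Finset.card_compl]
    omega
  obtain ⟨a, ha, b, hb, hab⟩ := Finset.one_lt_card.mp hcard
  simp only [Finset.mem_compl, Finset.mem_image, Finset.mem_univ, true_and, not_exists] at ha hb
  refine exists_mem_alternatingGroup_of_swap (P := fun τ => ∀ i, τ (t i) = t' i) hσ hab ?_
  intro i
  rw [Perm.mul_apply, hσ, swap_apply_of_ne_of_ne (ha i) (hb i)]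

end Transitivity

/-! ### Characters on subsets -/

section

open scoped Pointwise

section SubsetCharacters

variable {α : Type} [Fintype α] [DecidableEq α]

instance Set.powersetCard.finite (j : ℕ) : Finite (Set.powersetCard α j) :=
  Subtype.finite

/-- The number of `j`-subsets of `α` that are fixed by `σ`. -/
noncomputable def fixedSubsets (σ : Equiv.Perm α) (j : ℕ) : ℕ :=
  Nat.card {s : Finset α // s.card = j ∧ s.map σ.toEmbedding = s}

theorem smul_eq_of_forall_mem_iff {τ : alternatingGroup α} {s s' : Finset α}
    (h : ∀ x, (τ : Equiv.Perm α) x ∈ s' ↔ x ∈ s) : τ • s = s' := by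
  ext y
  rw [Finset.mem_smul_finset]
  constructor
  · rintro ⟨x, hx, rfl⟩
    exact (h x).2 hx
  · intro hy
    refine ⟨(τ : Equiv.Perm α)⁻¹ y, (h _).1 (by simpa using hy), ?_⟩
    change (τ : Equiv.Perm α) ((τ : Equiv.Perm α)⁻¹ y) = y
    simp

theorem card_orbits_subset_pairs_le (i j : ℕ)
    (hn : 5 ≤ Fintype.card α ∨ i + j + 2 ≤ Fintype.card α) :
    Nat.card (MulAction.orbitRel.Quotient (alternatingGroup α)
      (Set.powersetCard α i × Set.powersetCard α j)) ≤ min i j + 1 := by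
  have hle : ∀ p : Set.powersetCard α i × Set.powersetCard α j,
      ((p.1 : Finset α) ∩ (p.2 : Finset α)).card ≤ min i j := fun p =>
    le_min ((Finset.card_le_card Finset.inter_subset_left).trans p.1.2.le)
      ((Finset.card_le_card Finset.inter_subset_right).trans p.2.2.le)
  refine (card_orbits_le (fun p => ((p.1 : Finset α) ∩ (p.2 : Finset α)).card)
    (Finset.range (min i j + 1)) (fun p => ?_) ?_).trans (by simp)
  · exact Finset.mem_range_succ_iff.mpr (hle p)
  rintro ⟨⟨s, hs⟩, ⟨t, ht⟩⟩ ⟨⟨s', hs'⟩, ⟨t', ht'⟩⟩ h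
  simp only [Set.powersetCard.mem_iff] at hs ht hs' ht'
  simp only at h
  let c : Finset α → Finset α → α → Bool × Bool := fun s t x => (decide (x ∈ s), decide (x ∈ t))
  have hcard : ∀ (s t : Finset α) (b : Bool × Bool), Fintype.card {x // c s t x = b} =
      bif b.1 then (bif b.2 then (s ∩ t).card else s.card - (s ∩ t).card) else
        (bif b.2 then t.card - (s ∩ t).card else
          Fintype.card α - (s.card + t.card - (s ∩ t).card)) := by
    intro s t b
    rw [Fintype.card_subtype]
    rcases b with ⟨_ | _, _ | _⟩
    · have : (Finset.univ.filter fun x => c s t x = (false, false)) = (s ∪ t)ᶜ := by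
        ext; simp [c]
      rw [this, Finset.card_compl, Finset.card_union]
      rfl
    · have : (Finset.univ.filter fun x => c s t x = (false, true)) = t \ s := by
        ext; simp [c, and_comm]
      rw [this, Finset.card_sdiff]
      rfl
    · have : (Finset.univ.filter fun x => c s t x = (true, false)) = s \ t := by
        ext; simp [c]
      rw [this, Finset.card_sdiff, Finset.inter_comm]
      rfl
    · have : (Finset.univ.filter fun x => c s t x = (true, true)) = s ∩ t := by
        ext; simp [c]
      rw [this]
      rfl
  -- Membership in the two sets gives four colours: five points force a repetition, and otherwise
  -- two points lie outside both sets.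
  have h2 : ∃ a b, a ≠ b ∧ c s' t' a = c s' t' b := by
    rcases hn with hn | hn
    · exact Fintype.exists_ne_map_eq_of_card_lt _ (by simp; omega)
    · have : 1 < Fintype.card {x // c s' t' x = (false, false)} := by
        rw [hcard]
        simp only [cond_false]
        omega
      obtain ⟨⟨a, ha⟩, ⟨b, hb⟩, hab⟩ := Fintype.exists_pair_of_one_lt_card this
      exact ⟨a, b, fun h => hab (Subtype.ext h), ha.trans hb.symm⟩
  obtain ⟨τ, hτ⟩ := exists_alternating_of_card_fiber (c := c s t) (c' := c s' t')
    (fun b => by rw [hcard, hcard, hs, ht, hs', ht', h]) h2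
  refine ⟨τ, Prod.ext (Subtype.ext ?_) (Subtype.ext ?_)⟩
  · refine smul_eq_of_forall_mem_iff fun x => ?_
    simpa [c] using congrArg Prod.fst (hτ x)
  · refine smul_eq_of_forall_mem_iff fun x => ?_
    simpa [c] using congrArg Prod.snd (hτ x)

theorem le_card_orbits_subset_pairs {i j : ℕ} (hij : j ≤ i) (hn : i + j ≤ Fintype.card α) :
    j + 1 ≤ Nat.card (MulAction.orbitRel.Quotient (alternatingGroup α)
      (Set.powersetCard α i × Set.powersetCard α j)) := by
  refine le_trans (by simp) (le_card_orbits
    (fun p : Set.powersetCard α i × Set.powersetCard α j =>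
      ((p.1 : Finset α) ∩ (p.2 : Finset α)).card) ?_ (Finset.range (j + 1)) ?_)
  · intro g p
    have hs : ∀ {i : ℕ} (s : Set.powersetCard α i),
        ((g • s : Set.powersetCard α i) : Finset α) = g • (s : Finset α) := fun _ => rfl
    simp only [Prod.smul_fst, Prod.smul_snd, hs]
    rw [← Finset.smul_finset_inter, Finset.card_smul_finset]
  · intro t ht
    rw [Finset.mem_range_succ_iff] at ht
    obtain ⟨s, -, hs⟩ := Finset.exists_subset_card_eq (s := (Finset.univ : Finset α)) (n := i)
      (by rw [Finset.card_univ]; omega)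
    obtain ⟨u, hus, hu⟩ := Finset.exists_subset_card_eq (s := s) (n := t) (by omega)
    obtain ⟨v, hvs, hv⟩ := Finset.exists_subset_card_eq (s := sᶜ) (n := j - t)
      (by rw [Finset.card_compl]; omega)
    have hd : Disjoint s v := Finset.disjoint_left.mpr fun x hx hx' => by
      simpa [hx] using hvs hx'
    refine ⟨(⟨s, hs⟩, ⟨u ∪ v, ?_⟩), ?_⟩
    · rw [Set.powersetCard.mem_iff, Finset.card_union_of_disjoint (hd.mono_left hus)]
      omega
    · change (s ∩ (u ∪ v)).card = t
      rw [Finset.inter_union_distrib_left, Finset.disjoint_iff_inter_eq_empty.mp hd,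
        Finset.union_empty, Finset.inter_eq_right.mpr hus, hu]

theorem permCharacter_powersetCard (g : alternatingGroup α) (j : ℕ) :
    permCharacter (alternatingGroup α) (Set.powersetCard α j) g =
      fixedSubsets (g : Equiv.Perm α) j := by
  rw [permCharacter, fixedSubsets, Nat.cast_inj]
  refine Nat.card_congr ⟨fun s => ⟨s.1.1, s.1.2, ?_⟩, fun s => ⟨⟨s.1, s.2.1⟩, ?_⟩,
    fun _ => rfl, fun _ => rfl⟩
  · have h : g • s.1 = s.1 := s.2
    have h' := congrArg Subtype.val h
    rw [Finset.map_eq_image]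
    exact h'
  · refine Subtype.ext ?_
    have h' := s.2.2
    rw [Finset.map_eq_image] at h'
    exact h'

/-- The characters attached to two-row partitions. -/
theorem IsSignConjClass.fixedSubsets_sub_le {C : ConjClasses (alternatingGroup α)}
    (hC : IsSignConjClass C) {g : alternatingGroup α} (hg : g ∈ C.carrier) {j : ℕ}
    (hj : 2 * (j + 1) ≤ Fintype.card α)
    (hn : 5 ≤ Fintype.card α ∨ 2 * (j + 1) + 2 ≤ Fintype.card α) :
    fixedSubsets (g : Equiv.Perm α) (j + 1) ≤ fixedSubsets (g : Equiv.Perm α) j + 1 := by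
  set χ : ℕ → alternatingGroup α → ℂ := fun i =>
    permCharacter (alternatingGroup α) (Set.powersetCard α i) with hχ
  have hmem : ∀ i, χ i ∈ virtualCharacters (alternatingGroup α) := fun i =>
    permCharacter_mem_virtualCharacters _ _
  obtain ⟨a, b, ha, hb, hab⟩ := hC.abs_le_charForm hg (sub_mem (hmem (j + 1)) (hmem j))
  -- The norm is at most (j+2) + (j+1) − 2(j+1) = 1.
  have h1 := card_orbits_subset_pairs_le (α := α) (j + 1) (j + 1) (by omega)
  have h2 := card_orbits_subset_pairs_le (α := α) j j (by omega)
  have h3 := le_card_orbits_subset_pairs (α := α) (i := j + 1) (j := j) (by omega) (by omega)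
  simp only [charForm_sub_left, charForm_sub_right] at hb
  rw [charForm_comm (χ j) (χ (j + 1))] at hb
  simp only [hχ, charForm_permCharacter] at hb
  simp only [Pi.sub_apply, hχ, permCharacter_powersetCard] at ha
  norm_cast at ha hb
  simp only [Int.subNatNat_eq_coe] at hb
  simp only [min_self] at h1 h2
  have := le_abs_self a
  rw [Int.subNatNat_eq_coe] at ha
  omega

end SubsetCharacters

end

/-! ### Characters on ordered pairs and the hook -/

section

open scoped Pointwise

section PairCharacters

variable {α : Type} [Fintype α] [DecidableEq α]

theorem card_orbits_embedding_pairs_le (hn : 6 ≤ Fintype.card α) :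
    Nat.card (MulAction.orbitRel.Quotient (alternatingGroup α)
      ((Fin 2 ↪ α) × (Fin 2 ↪ α))) ≤ 7 := by
  -- The coincidences between two ordered pairs form a partial matching: one empty, four with one
  -- edge, two with two edges.
  let S : Finset (Bool × Bool × Bool × Bool) :=
    {(false, false, false, false), (true, false, false, false), (false, true, false, false),
      (false, false, true, false), (false, false, false, true), (true, false, false, true),
      (false, true, true, false)}
  have hS : S.card = 7 := by decide
  rw [← hS]
  refine card_orbits_le (fun p : (Fin 2 ↪ α) × (Fin 2 ↪ α) =>
    (decide (p.1 0 = p.2 0), decide (p.1 0 = p.2 1), decide (p.1 1 = p.2 0),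
      decide (p.1 1 = p.2 1))) S ?_ ?_
  · rintro ⟨p, q⟩
    have hp : p 0 ≠ p 1 := fun h => by simpa using p.injective h
    have hq : q 0 ≠ q 1 := fun h => by simpa using q.injective h
    have key : ∀ a b c d : Bool, ¬(a ∧ b) → ¬(a ∧ c) → ¬(b ∧ d) → ¬(c ∧ d) →
      (a, b, c, d) ∈ S := by decide
    apply key <;> simp only [decide_eq_true_eq] <;> rintro ⟨h1, h2⟩
    · exact hq (h1.symm.trans h2)
    · exact hp (h1.trans h2.symm)
    · exact hp (h1.trans h2.symm)
    · exact hq (h1.symm.trans h2)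
  · rintro ⟨p, q⟩ ⟨p', q'⟩ h
    simp only [Prod.mk.injEq, decide_eq_decide] at h
    obtain ⟨h00, h01, h10, h11⟩ := h
    obtain ⟨τ, hτ⟩ := exists_alternating_of_ker_eq (m := 4) (by omega)
      (t := ![p 0, p 1, q 0, q 1]) (t' := ![p' 0, p' 1, q' 0, q' 1]) (by
        intro i j
        fin_cases i <;> fin_cases j <;>
          simp [p.injective.eq_iff, p'.injective.eq_iff, q.injective.eq_iff, q'.injective.eq_iff,
            h00, h01, h10, h11, eq_comm (a := q 0), eq_comm (a := q 1), eq_comm (a := q' 0),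
            eq_comm (a := q' 1)])
    refine ⟨τ, Prod.ext ?_ ?_⟩
    · ext i
      fin_cases i
      · exact hτ 0
      · exact hτ 1
    · ext i
      fin_cases i
      · exact hτ 2
      · exact hτ 3

theorem card_orbits_embedding_empty_le (hn : 4 ≤ Fintype.card α) :
    Nat.card (MulAction.orbitRel.Quotient (alternatingGroup α)
      ((Fin 2 ↪ α) × Set.powersetCard α 0)) ≤ 1 := by
  refine (card_orbits_le (fun _ => ()) {()} (fun _ => by simp) ?_).trans (by simp)
  rintro ⟨p, s, hs⟩ ⟨p', s', hs'⟩ -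
  obtain ⟨τ, hτ⟩ := exists_alternating_of_ker_eq (m := 2) hn (t := p) (t' := p')
    (fun i j => by rw [p.injective.eq_iff, p'.injective.eq_iff])
  refine ⟨τ, Prod.ext ?_ (Subtype.ext ?_)⟩
  · ext i
    exact hτ i
  · rw [Set.powersetCard.mem_iff, Finset.card_eq_zero] at hs hs'
    subst hs hs'
    exact Finset.smul_finset_empty _

theorem smul_mem_smul_iff_alternating (g : alternatingGroup α) (x : α) {i : ℕ}
    (s : Set.powersetCard α i) :
    (g • x ∈ ((g • s : Set.powersetCard α i) : Finset α)) ↔ x ∈ (s : Finset α) :=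
  Finset.smul_mem_smul_finset_iff (g : Equiv.Perm α)

theorem le_card_orbits_embedding_pair (hn : 4 ≤ Fintype.card α) :
    4 ≤ Nat.card (MulAction.orbitRel.Quotient (alternatingGroup α)
      ((Fin 2 ↪ α) × Set.powersetCard α 2)) := by
  refine le_trans (by simp) (le_card_orbits (fun p : (Fin 2 ↪ α) × Set.powersetCard α 2 =>
    (decide (p.1 0 ∈ (p.2 : Finset α)), decide (p.1 1 ∈ (p.2 : Finset α)))) ?_
    (Finset.univ : Finset (Bool × Bool)) ?_)
  · intro g p
    exact Prod.ext (decide_eq_decide.mpr (smul_mem_smul_iff_alternating g _ _))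
      (decide_eq_decide.mpr (smul_mem_smul_iff_alternating g _ _))
  · rintro ⟨a, b⟩ -
    obtain ⟨e⟩ : Nonempty (Fin 4 ↪ α) := Function.Embedding.nonempty_of_card_le (by simpa using hn)
    let p : Fin 2 ↪ α := ⟨![e 0, e 1], by
      intro i j
      fin_cases i <;> fin_cases j <;> simp [e.injective.eq_iff]⟩
    have key : ∀ a b : Bool, ∃ s : Finset (Fin 4), s.card = 2 ∧ decide (0 ∈ s) = a ∧
      decide (1 ∈ s) = b := by decide
    obtain ⟨s, hs, h0, h1⟩ := key a b
    refine ⟨(p, ⟨s.map e, ?_⟩), ?_⟩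
    · rw [Set.powersetCard.mem_iff, Finset.card_map, hs]
    · rw [← h0, ← h1]
      exact Prod.ext (decide_eq_decide.mpr (Finset.mem_map' e))
        (decide_eq_decide.mpr (Finset.mem_map' e))

theorem le_card_orbits_embedding_point (hn : 3 ≤ Fintype.card α) :
    3 ≤ Nat.card (MulAction.orbitRel.Quotient (alternatingGroup α)
      ((Fin 2 ↪ α) × Set.powersetCard α 1)) := by
  refine le_trans (b := ({(false, false), (false, true), (true, false)} :
    Finset (Bool × Bool)).card) (by decide) (le_card_orbits
    (fun p : (Fin 2 ↪ α) × Set.powersetCard α 1 =>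
    (decide (p.1 0 ∈ (p.2 : Finset α)), decide (p.1 1 ∈ (p.2 : Finset α)))) ?_ _ ?_)
  · intro g p
    exact Prod.ext (decide_eq_decide.mpr (smul_mem_smul_iff_alternating g _ _))
      (decide_eq_decide.mpr (smul_mem_smul_iff_alternating g _ _))
  · rintro ⟨a, b⟩ hab
    obtain ⟨e⟩ : Nonempty (Fin 3 ↪ α) := Function.Embedding.nonempty_of_card_le (by simpa using hn)
    let p : Fin 2 ↪ α := ⟨![e 0, e 1], by
      intro i j
      fin_cases i <;> fin_cases j <;> simp [e.injective.eq_iff]⟩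
    have key : ∀ a b : Bool, (a, b) ∈ ({(false, false), (false, true), (true, false)} :
      Finset (Bool × Bool)) → ∃ s : Finset (Fin 3), s.card = 1 ∧ decide (0 ∈ s) = a ∧
      decide (1 ∈ s) = b := by decide
    obtain ⟨s, hs, h0, h1⟩ := key a b hab
    refine ⟨(p, ⟨s.map e, ?_⟩), ?_⟩
    · rw [Set.powersetCard.mem_iff, Finset.card_map, hs]
    · rw [← h0, ← h1]
      exact Prod.ext (decide_eq_decide.mpr (Finset.mem_map' e))
        (decide_eq_decide.mpr (Finset.mem_map' e))

/-- The character attached to the hook partition `(n - 2, 1, 1)`. -/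
theorem IsSignConjClass.fixedSubsets_two_le {C : ConjClasses (alternatingGroup α)}
    (hC : IsSignConjClass C) {g : alternatingGroup α} (hg : g ∈ C.carrier)
    (hn : 6 ≤ Fintype.card α) :
    fixedSubsets (g : Equiv.Perm α) 2 + fixedSubsets (g : Equiv.Perm α) 1 ≤
      Nat.card (MulAction.fixedBy (Fin 2 ↪ α) g) + fixedSubsets (g : Equiv.Perm α) 0 + 1 := by
  set χ : ℕ → alternatingGroup α → ℂ := fun i =>
    permCharacter (alternatingGroup α) (Set.powersetCard α i) with hχ
  set δ : alternatingGroup α → ℂ := permCharacter (alternatingGroup α) (Fin 2 ↪ α) with hδ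
  have hmem : ∀ i, χ i ∈ virtualCharacters (alternatingGroup α) := fun i =>
    permCharacter_mem_virtualCharacters _ _
  have hmem' : δ ∈ virtualCharacters (alternatingGroup α) := permCharacter_mem_virtualCharacters _ _
  obtain ⟨a, b, ha, hb, hab⟩ := hC.abs_le_charForm hg
    (sub_mem (add_mem hmem' (hmem 0)) (add_mem (hmem 2) (hmem 1)))
  -- The diagonal terms give at most 7 + 1 + 3 + 2, and the cross terms at most 2(1 − 4 − 3 − 1 − 1
  -- + 2), so the norm is at most 1.
  have hdd := card_orbits_embedding_pairs_le hn
  have hdt := card_orbits_embedding_empty_le (α := α) (by omega)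
  have hdb := le_card_orbits_embedding_pair (α := α) (by omega)
  have hda := le_card_orbits_embedding_point (α := α) (by omega)
  have hbb := card_orbits_subset_pairs_le (α := α) 2 2 (by omega)
  have haa := card_orbits_subset_pairs_le (α := α) 1 1 (by omega)
  have htt := card_orbits_subset_pairs_le (α := α) 0 0 (by omega)
  have hba := card_orbits_subset_pairs_le (α := α) 2 1 (by omega)
  have hbt := le_card_orbits_subset_pairs (α := α) (i := 2) (j := 0) (by omega) (by omega)
  have hat := le_card_orbits_subset_pairs (α := α) (i := 1) (j := 0) (by omega) (by omega)
  simp only [charForm_sub_left, charForm_sub_right, charForm_add_left, charForm_add_right] at hb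
  rw [charForm_comm (χ 0) δ, charForm_comm (χ 2) δ, charForm_comm (χ 1) δ,
    charForm_comm (χ 0) (χ 2), charForm_comm (χ 0) (χ 1), charForm_comm (χ 1) (χ 2)] at hb
  simp only [hχ, hδ, charForm_permCharacter] at hb
  simp only [Pi.sub_apply, Pi.add_apply, hχ, permCharacter_powersetCard] at ha
  rw [show δ g = (Nat.card (MulAction.fixedBy (Fin 2 ↪ α) g) : ℂ) from rfl] at ha
  norm_cast at ha hb
  simp only [Int.subNatNat_eq_coe] at ha hb
  push_cast at ha hb
  norm_num at hbb haa htt hba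
  have := neg_abs_le a
  omega

end PairCharacters

end

/-! ### Counting invariant subsets by cycle type -/

section FixedSubsets

open Equiv.Perm

variable {α : Type} [Fintype α] [DecidableEq α] {σ : Equiv.Perm α}

theorem fixedSubsets_eq_card (σ : Equiv.Perm α) (j : ℕ) : fixedSubsets σ j =
    (Finset.univ.filter fun s : Finset α => s.card = j ∧ s.map σ.toEmbedding = s).card := by
  rw [fixedSubsets, Nat.card_eq_fintype_card, Fintype.card_subtype]

theorem apply_mem_of_map_eq {α : Type} {σ : Equiv.Perm α} {s : Finset α}
    (hs : s.map σ.toEmbedding = s) {x : α} :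
    σ x ∈ s ↔ x ∈ s := by
  conv_lhs => rw [← hs]
  exact Finset.mem_map' σ.toEmbedding

theorem support_cycleOf_subset {s : Finset α} (hs : s.map σ.toEmbedding = s) {x : α} (hx : x ∈ s) :
    (σ.cycleOf x).support ⊆ s := by
  intro y hy
  obtain ⟨⟨i, rfl⟩, -⟩ := mem_support_cycleOf_iff.mp hy
  induction i with
  | zero => simpa using hx
  | succ i ih =>
    have hz : ∀ i : ℕ, (σ ^ i) x ∈ s := fun i => by
      induction i with
      | zero => simpa using hx
      | succ i ih => rw [pow_succ']; exact (apply_mem_of_map_eq hs).2 ih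
    exact_mod_cast hz (i + 1)
  | pred i ih =>
    have hz : ∀ i : ℕ, (σ ^ (-(i : ℤ))) x ∈ s := fun i => by
      induction i with
      | zero => simpa using hx
      | succ i ih =>
        rw [← apply_mem_of_map_eq hs, ← Equiv.Perm.mul_apply]
        convert ih using 2
        group
    convert hz (i + 1) using 3
    push_cast
    ring

/-- An invariant set with a moved point contains the whole cycle of that point, hence at least k
elements. -/
theorem subset_compl_support_of_card_lt {k : ℕ} (hk : ∀ c ∈ σ.cycleType, k ≤ c) {s : Finset α}
    (hs : s.map σ.toEmbedding = s) (hsk : s.card < k) : s ⊆ σ.supportᶜ := by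
  intro x hx
  rw [Finset.mem_compl]
  intro hxs
  have h1 : k ≤ (σ.cycleOf x).support.card := hk _ (by
    rw [cycleType_def]
    exact Multiset.mem_map.mpr ⟨_, cycleOf_mem_cycleFactorsFinset_iff.mpr hxs, rfl⟩)
  exact absurd (Finset.card_le_card (support_cycleOf_subset hs hx)) (by omega)

theorem map_eq_of_subset_compl_support {s : Finset α} (hs : s ⊆ σ.supportᶜ) :
    s.map σ.toEmbedding = s := by
  ext y
  rw [Finset.mem_map]
  have : ∀ x ∈ s, σ x = x := fun x hx => by simpa using hs hx
  constructor
  · rintro ⟨x, hx, rfl⟩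
    rw [Equiv.coe_toEmbedding, this x hx]
    exact hx
  · exact fun hy => ⟨y, hy, this y hy⟩

theorem map_support_eq {c : Equiv.Perm α} (hc : c ∈ σ.cycleFactorsFinset) :
    c.support.map σ.toEmbedding = c.support := by
  refine Finset.eq_of_subset_of_card_le (fun y hy => ?_) (by rw [Finset.card_map])
  obtain ⟨x, hx, rfl⟩ := Finset.mem_map.mp hy
  have h2 := (mem_cycleFactorsFinset_iff.mp hc).2 x hx
  rw [Equiv.coe_toEmbedding, ← h2]
  exact apply_mem_support.mpr hx

theorem fixedSubsets_of_lt {k j : ℕ} (hk : ∀ c ∈ σ.cycleType, k ≤ c) (hj : j < k) :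
    fixedSubsets σ j = (σ.supportᶜ.card).choose j := by
  rw [fixedSubsets_eq_card, ← Finset.card_powersetCard]
  congr 1
  ext s
  simp only [Finset.mem_filter, Finset.mem_univ, true_and, Finset.mem_powersetCard]
  constructor
  · rintro ⟨h1, h2⟩
    exact ⟨subset_compl_support_of_card_lt hk h2 (h1 ▸ hj), h1⟩
  · rintro ⟨h1, h2⟩
    exact ⟨h2, map_eq_of_subset_compl_support h1⟩

theorem count_cycleType (σ : Equiv.Perm α) (k : ℕ) : σ.cycleType.count k =
    (σ.cycleFactorsFinset.filter fun c => c.support.card = k).card := by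
  rw [cycleType_def, Multiset.count_map]
  simp only [Function.comp_apply, eq_comm (a := k)]
  rfl

theorem support_injOn_cycleFactorsFinset (σ : Equiv.Perm α) :
    Set.InjOn Equiv.Perm.support (σ.cycleFactorsFinset : Set (Equiv.Perm α)) := by
  intro c hc d hd h
  by_contra hne
  have h1 := (cycleFactorsFinset_pairwise_disjoint σ hc hd hne).disjoint_support
  rw [← h, disjoint_self, Finset.bot_eq_empty, Equiv.Perm.support_eq_empty_iff] at h1
  exact (mem_cycleFactorsFinset_iff.mp hc).1.ne_one h1

theorem card_supports (σ : Equiv.Perm α) (k : ℕ) :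
    ((σ.cycleFactorsFinset.filter fun c => c.support.card = k).image Equiv.Perm.support).card =
      σ.cycleType.count k := by
  rw [count_cycleType]
  refine Finset.card_image_of_injOn fun c hc d hd h => ?_
  simp only [Finset.coe_filter, Set.mem_ofPred_eq] at hc hd
  exact support_injOn_cycleFactorsFinset σ hc.1 hd.1 h

/-- Supports of k-cycles and k-sets of fixed points are invariant, and no set is of both kinds
because k ≠ 0. -/
theorem count_add_choose_le_fixedSubsets (σ : Equiv.Perm α) {k : ℕ} (hk : k ≠ 0) :
    σ.cycleType.count k + (σ.supportᶜ.card).choose k ≤ fixedSubsets σ k := by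
  rw [← card_supports, ← Finset.card_powersetCard, ← Finset.card_union_of_disjoint,
    fixedSubsets_eq_card]
  · refine Finset.card_le_card fun s hs => ?_
    rw [Finset.mem_filter]
    refine ⟨Finset.mem_univ _, ?_⟩
    rcases Finset.mem_union.mp hs with h | h
    · obtain ⟨c, hc, rfl⟩ := Finset.mem_image.mp h
      rw [Finset.mem_filter] at hc
      exact ⟨hc.2, map_support_eq hc.1⟩
    · rw [Finset.mem_powersetCard] at h
      exact ⟨h.2, map_eq_of_subset_compl_support h.1⟩
  · rw [Finset.disjoint_left]
    intro s hs hs'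
    obtain ⟨c, hc, rfl⟩ := Finset.mem_image.mp hs
    rw [Finset.mem_filter] at hc
    rw [Finset.mem_powersetCard] at hs'
    have hne : c.support.Nonempty := Finset.card_pos.mp (by omega)
    obtain ⟨x, hx⟩ := hne
    exact Finset.mem_compl.mp (hs'.1 hx) (mem_cycleFactorsFinset_support_le hc.1 hx)

/-- An invariant k-set with a moved point contains a cycle of length at least k, so it equals the
support of that cycle. -/
theorem fixedSubsets_le_count_add_choose {k : ℕ} (hk : ∀ c ∈ σ.cycleType, k ≤ c) :
    fixedSubsets σ k ≤ σ.cycleType.count k + (σ.supportᶜ.card).choose k := by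
  rw [← card_supports, ← Finset.card_powersetCard, fixedSubsets_eq_card]
  refine (Finset.card_le_card fun s hs => ?_).trans (Finset.card_union_le _ _)
  simp only [Finset.mem_filter, Finset.mem_univ, true_and] at hs
  rw [Finset.mem_union, Finset.mem_powersetCard]
  by_cases h : s ⊆ σ.supportᶜ
  · exact Or.inr ⟨h, hs.1⟩
  · left
    rw [Finset.not_subset] at h
    obtain ⟨x, hx, hxs⟩ := h
    rw [Finset.mem_compl, not_not] at hxs
    have hc := cycleOf_mem_cycleFactorsFinset_iff.mpr hxs
    have hle : k ≤ (σ.cycleOf x).support.card := hk _ (by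
      rw [cycleType_def]
      exact Multiset.mem_map.mpr ⟨_, hc, rfl⟩)
    have hss := support_cycleOf_subset hs.2 hx
    have heq : (σ.cycleOf x).support = s :=
      Finset.eq_of_subset_of_card_le hss (by omega)
    exact Finset.mem_image.mpr ⟨_, Finset.mem_filter.mpr ⟨hc, by rw [heq, hs.1]⟩, heq⟩

/-- A k-cycle with one fixed point added is invariant; intersecting with the support of σ and its
complement recovers both. -/
theorem count_mul_card_le_fixedSubsets (σ : Equiv.Perm α) (k : ℕ) :
    σ.cycleType.count k * σ.supportᶜ.card ≤ fixedSubsets σ (k + 1) := by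
  rw [count_cycleType, ← Finset.card_product, fixedSubsets_eq_card]
  have hmem : ∀ p ∈ (σ.cycleFactorsFinset.filter fun c => c.support.card = k) ×ˢ σ.supportᶜ,
      p.1 ∈ σ.cycleFactorsFinset ∧ p.1.support.card = k ∧ p.2 ∉ σ.support := by
    intro p hp
    simpa [and_assoc] using hp
  refine Finset.card_le_card_of_injOn (fun p => insert p.2 p.1.support) ?_ ?_
  · intro p hp
    obtain ⟨h1, h2, h3⟩ := hmem p hp
    simp only [Finset.coe_filter, Finset.mem_univ, true_and, Set.mem_ofPred_eq]
    constructor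
    · rw [Finset.card_insert_of_notMem fun h => h3 (mem_cycleFactorsFinset_support_le h1 h), h2]
    · rw [Finset.map_insert, map_support_eq h1, Equiv.coe_toEmbedding, notMem_support.mp h3]
  · intro p hp q hq h
    obtain ⟨h1, h2, h3⟩ := hmem p hp
    obtain ⟨h1', h2', h3'⟩ := hmem q hq
    have key : ∀ (c : Equiv.Perm α) (x : α), c ∈ σ.cycleFactorsFinset → x ∉ σ.support →
        (insert x c.support).filter (· ∈ σ.support) = c.support ∧
        (insert x c.support).filter (· ∉ σ.support) = {x} := by
      intro c x hc hx
      have hcs := mem_cycleFactorsFinset_support_le hc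
      constructor
      · ext y
        simp only [Finset.mem_filter, Finset.mem_insert]
        exact ⟨fun ⟨h, h'⟩ => h.resolve_left fun e => hx (e ▸ h'), fun h => ⟨Or.inr h, hcs h⟩⟩
      · ext y
        simp only [Finset.mem_filter, Finset.mem_insert, Finset.mem_singleton]
        exact ⟨fun ⟨h, h'⟩ => h.resolve_right fun e => h' (hcs e), fun h => ⟨Or.inl h, h ▸ hx⟩⟩
    simp only at h
    have e1 := (key _ _ h1 h3).1
    have e2 := (key _ _ h1 h3).2
    rw [h] at e1 e2
    rw [(key _ _ h1' h3').1] at e1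
    rw [(key _ _ h1' h3').2] at e2
    exact Prod.ext (support_injOn_cycleFactorsFinset σ h1 h1' e1.symm)
      (Finset.singleton_injective e2).symm

theorem card_fixedBy_embedding_le (g : alternatingGroup α) :
    Nat.card (MulAction.fixedBy (Fin 2 ↪ α) g) ≤
      (g : Equiv.Perm α).supportᶜ.card * ((g : Equiv.Perm α).supportᶜ.card - 1) := by
  have h : Nat.card (Fin 2 ↪ ((g : Equiv.Perm α).supportᶜ : Finset α)) =
      (g : Equiv.Perm α).supportᶜ.card * ((g : Equiv.Perm α).supportᶜ.card - 1) := by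
    rw [Nat.card_eq_fintype_card, Fintype.card_embedding_eq, Fintype.card_coe, Fintype.card_fin]
    simp [Nat.descFactorial_succ, mul_comm]
  rw [← h]
  have hfix : ∀ (p : MulAction.fixedBy (Fin 2 ↪ α) g) (i : Fin 2),
      p.1 i ∈ (g : Equiv.Perm α).supportᶜ := by
    intro p i
    rw [Finset.mem_compl, notMem_support]
    exact congrArg (fun f : Fin 2 ↪ α => f i) p.2
  refine Nat.card_le_card_of_injective (fun p => ⟨fun i => ⟨p.1 i, hfix p i⟩, fun i j hij => ?_⟩) ?_
  · exact p.1.injective (congrArg Subtype.val hij)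
  · intro p q hpq
    ext i
    exact congrArg (fun f : Fin 2 ↪ ((g : Equiv.Perm α).supportᶜ : Finset α) => (f i : α)) hpq

end FixedSubsets

/-! ### Fixed points and the shortest nontrivial cycle -/

section SmallestPart

open Equiv.Perm

variable {α : Type} [Fintype α] [DecidableEq α]

theorem IsSignConjClass.card_fixed_le_two {C : ConjClasses (alternatingGroup α)}
    (hC : IsSignConjClass C) {g : alternatingGroup α} (hg : g ∈ C.carrier)
    (hn : 4 ≤ Fintype.card α) : (g : Equiv.Perm α).supportᶜ.card ≤ 2 := by
  have h := hC.fixedSubsets_sub_le hg (j := 0) (by omega) (by omega)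
  rw [fixedSubsets_of_lt (k := 2) (fun c hc => two_le_of_mem_cycleType hc) (by norm_num),
    fixedSubsets_of_lt (k := 2) (fun c hc => two_le_of_mem_cycleType hc) (by norm_num)] at h
  simpa using h

theorem IsSignConjClass.count_le_one_of_forall_le {C : ConjClasses (alternatingGroup α)}
    (hC : IsSignConjClass C) {g : alternatingGroup α} (hg : g ∈ C.carrier)
    {k : ℕ} (hk2 : 2 ≤ k) (hk : ∀ c ∈ (g : Equiv.Perm α).cycleType, k ≤ c)
    (hf : (g : Equiv.Perm α).supportᶜ.card ≤ 2)
    (hn : Fintype.card α ≠ 4) (hn' : Fintype.card α ≠ 5) :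
    (g : Equiv.Perm α).cycleType.count k ≤ 1 := by
  by_contra! hcount
  have hcard : 2 * k + (g : Equiv.Perm α).supportᶜ.card ≤ Fintype.card α := by
    have h1 : Multiset.replicate 2 k ≤ (g : Equiv.Perm α).cycleType :=
      Multiset.le_count_iff_replicate_le.mp hcount
    obtain ⟨t, ht⟩ := Multiset.le_iff_exists_add.mp h1
    have h2 := congrArg Multiset.sum ht
    rw [Multiset.sum_add, Multiset.sum_replicate, sum_cycleType, smul_eq_mul] at h2
    have h3 := Finset.card_compl (g : Equiv.Perm α).support
    have h4 := Finset.card_le_univ (g : Equiv.Perm α).support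
    omega
  have hlow := count_add_choose_le_fixedSubsets (g : Equiv.Perm α) (k := k) (by omega)
  generalize hfd : (g : Equiv.Perm α).supportᶜ.card = f at *
  -- With so few fixed points no (k − 1)-set is invariant, so at most one k-set is. What remains is
  -- k = 2 with f ≥ 1, or k = 3 with f = 2.
  by_cases hcase : f < k - 1
  · obtain ⟨j, rfl⟩ : ∃ j, k = j + 1 := ⟨k - 1, by omega⟩
    have h := hC.fixedSubsets_sub_le hg (j := j) (by omega) (by omega)
    rw [fixedSubsets_of_lt hk (Nat.lt_succ_self j), hfd, Nat.choose_eq_zero_of_lt (by omega)] at h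
    omega
  have hk3 : k ≤ 3 := by omega
  interval_cases k
  -- At least C(f,2) + 2 pairs are invariant, so the hook value f(f−1) + 1 − C(f,2) − 2 − f, which
  -- is −2 for f = 1 and f = 2, bounds the character from above.
  · have h := hC.fixedSubsets_two_le hg (by omega)
    rw [fixedSubsets_of_lt hk (j := 1) (by norm_num), fixedSubsets_of_lt hk (j := 0) (by norm_num),
      hfd, Nat.choose_one_right, Nat.choose_zero_right] at h
    have h2 := card_fixedBy_embedding_le g
    rw [hfd] at h2
    have : f = 1 ∨ f = 2 := by omega
    rcases this with rfl | rfl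
    · omega
    · rw [Nat.choose_self] at hlow
      omega
  -- If there are c cycles of length 3, at least 2c of the 4-sets and at most c of the 3-sets are
  -- invariant, so 2c ≤ c + 1.
  · have hf2 : f = 2 := by omega
    subst hf2
    have h := hC.fixedSubsets_sub_le hg (j := 3) (by omega) (by omega)
    have h1 := fixedSubsets_le_count_add_choose hk
    have h2 := count_mul_card_le_fixedSubsets (g : Equiv.Perm α) 3
    rw [hfd] at h1 h2
    norm_num at h h1 h2
    omega

end SmallestPart

/-! ### Rationality and congruences modulo 2 of character values -/

section Integrality

open scoped IsMulCommutative in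
theorem Representation.exists_eigenvalues_of_isMulCommutative {G : Type} [Group G] [Finite G]
    [IsMulCommutative G] (x : G) (V : Type) [AddCommGroup V] [Module ℂ V] [FiniteDimensional ℂ V]
    (ρ : Representation ℂ G V) : ∃ M : Multiset ℂ, (∀ μ ∈ M, IsIntegral ℤ μ) ∧
      ρ.character x = M.sum ∧ ρ.character (x ^ 2) = (M.map (· ^ 2)).sum := by
  refine Representation.induction_of_isCompl (G := G) (P := fun V _ _ ρ =>
    ∃ M : Multiset ℂ, (∀ μ ∈ M, IsIntegral ℤ μ) ∧ ρ.character x = M.sum ∧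
      ρ.character (x ^ 2) = (M.map (· ^ 2)).sum) ?_ ?_ ?_ V ρ
  · intro V _ _ ρ hV
    have h : ∀ g, ρ.character g = 0 := fun g => by
      have : ρ g = 0 := Subsingleton.elim _ _
      simp [character, this]
    exact ⟨0, by simp, by simp [h], by simp [h]⟩
  · intro V _ _ _ ρ hρ
    have h1 : finrank ℂ V = 1 := IsIrreducible.finrank_eq_one_of_isMulCommutative ρ
    obtain ⟨μ, hμ⟩ : ∃ μ : ℂ, ρ x = μ • LinearMap.id := by
      obtain ⟨v, hv, hspan⟩ := finrank_eq_one_iff'.mp h1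
      obtain ⟨μ, hμ⟩ := hspan (ρ x v)
      refine ⟨μ, LinearMap.ext fun w => ?_⟩
      obtain ⟨c, rfl⟩ := hspan w
      rw [map_smul, ← hμ, LinearMap.smul_apply, LinearMap.id_apply, smul_comm]
    have hpow : ∀ j : ℕ, ρ (x ^ j) = μ ^ j • LinearMap.id := by
      intro j
      induction j with
      | zero => simp; rfl
      | succ j ih =>
        rw [pow_succ, map_mul, ih, hμ, pow_succ, mul_smul]
        ext v
        simp [smul_comm μ]
    have hchar : ∀ j : ℕ, ρ.character (x ^ j) = μ ^ j := by
      intro j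
      rw [character, hpow, map_smul, LinearMap.trace_id, h1]
      simp
    refine ⟨{μ}, ?_, by simpa using hchar 1, by simpa using hchar 2⟩
    intro ν hν
    rw [Multiset.mem_singleton] at hν
    subst hν
    have hN := hchar (Nat.card G)
    rw [pow_card_eq_one', char_one, h1, Nat.cast_one] at hN
    exact IsIntegral.of_pow Nat.card_pos (hN ▸ isIntegral_one)
  · rintro V _ _ _ ρ W W' h ⟨M, hM, hM1, hM2⟩ ⟨M', hM', hM1', hM2'⟩
    refine ⟨M + M', ?_, ?_, ?_⟩
    · intro μ hμ
      exact (Multiset.mem_add.mp hμ).elim (hM μ) (hM' μ)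
    · rw [character_eq_add_of_isCompl h, Multiset.sum_add, Pi.add_apply, hM1, hM1']
    · rw [character_eq_add_of_isCompl h, Multiset.map_add, Multiset.sum_add, Pi.add_apply, hM2,
        hM2']

variable {G : Type} [Group G] [Finite G] {V : Type} [AddCommGroup V] [Module ℂ V]
  [FiniteDimensional ℂ V]

/-- Restriction to the cyclic group generated by x splits into one-dimensional representations; M is
the multiset of eigenvalues of x. -/
theorem Representation.exists_eigenvalues (ρ : Representation ℂ G V) (x : G) :
    ∃ M : Multiset ℂ, (∀ μ ∈ M, IsIntegral ℤ μ) ∧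
      ρ.character x = M.sum ∧ ρ.character (x ^ 2) = (M.map (· ^ 2)).sum :=
  exists_eigenvalues_of_isMulCommutative (⟨x, Subgroup.mem_zpowers x⟩ : Subgroup.zpowers x) V
    (ρ.comp (Subgroup.zpowers x).subtype)

theorem Representation.isIntegral_character (ρ : Representation ℂ G V) (x : G) :
    IsIntegral ℤ (ρ.character x) := by
  obtain ⟨M, hM, h, -⟩ := ρ.exists_eigenvalues x
  rw [h]
  exact IsIntegral.multiset_sum hM

/-- The witness t is the second elementary symmetric function of M. -/
theorem exists_isIntegral_sum_sq (M : Multiset ℂ) (hM : ∀ μ ∈ M, IsIntegral ℤ μ) :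
    ∃ t : ℂ, IsIntegral ℤ t ∧ M.sum ^ 2 - (M.map (· ^ 2)).sum = 2 * t := by
  induction M using Multiset.induction_on with
  | empty => exact ⟨0, isIntegral_zero, by simp⟩
  | cons μ M ih =>
    obtain ⟨t, ht, h⟩ := ih fun ν hν => hM ν (Multiset.mem_cons_of_mem hν)
    refine ⟨μ * M.sum + t, ((hM μ (Multiset.mem_cons_self _ _)).mul
      (IsIntegral.multiset_sum fun ν hν => hM ν (Multiset.mem_cons_of_mem hν))).add ht, ?_⟩
    rw [Multiset.sum_cons, Multiset.map_cons, Multiset.sum_cons]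
    linear_combination h

theorem exists_int_of_isIntegral_of_rat {z : ℂ} (hz : IsIntegral ℤ z) {q : ℚ} (hq : z = q) :
    ∃ m : ℤ, z = m := by
  have : IsIntegral ℤ q := by
    rw [hq] at hz
    exact (isIntegral_algebraMap_iff (A := ℚ) (B := ℂ) (algebraMap ℚ ℂ).injective).mp hz
  obtain ⟨m, hm⟩ := IsIntegrallyClosed.isIntegral_iff.mp this
  refine ⟨m, ?_⟩
  rw [hq, ← hm]
  simp

/-- If every element is conjugate to the other generators of the cyclic group it generates, then
all characters have rational values. -/
theorem Representation.exists_rat_character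
    (hG : ∀ (x : G) (j : ℕ), (orderOf x).Coprime j → IsConj x (x ^ j))
    (ρ : Representation ℂ G V) (x : G) : ∃ q : ℚ, ρ.character x = q := by
  classical
  induction hN : orderOf x using Nat.strong_induction_on generalizing x with
  | _ N ih =>
    have := Fintype.ofFinite (Subgroup.zpowers x)
    have : Invertible (Nat.card (Subgroup.zpowers x) : ℂ) :=
      invertibleOfNonzero (Nat.cast_ne_zero.mpr Nat.card_pos.ne')
    -- The sum of the character over the cyclic group is an integer. The generators all contribute
    -- the value at x, and the other elements have smaller order, so their values are rational by
    -- induction.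
    have h := card_inv_mul_sum_char_eq_finrank (ρ.comp (Subgroup.zpowers x).subtype)
    rw [inv_mul_eq_iff_eq_mul₀ (Nat.cast_ne_zero.mpr Nat.card_pos.ne'),
      ← Finset.sum_filter_add_sum_filter_not Finset.univ
        (fun h : Subgroup.zpowers x => orderOf (h : G) = N)] at h
    have hmem : ∀ h : Subgroup.zpowers x, ∃ j : ℕ, (h : G) = x ^ j := fun h => by
      obtain ⟨j, hj⟩ := (mem_powers_iff_mem_zpowers).mpr h.2
      exact ⟨j, hj.symm⟩
    have h1 : ∀ h : Subgroup.zpowers x, orderOf (h : G) = N →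
        character (ρ.comp (Subgroup.zpowers x).subtype) h = ρ.character x := by
      intro h hh
      obtain ⟨j, hj⟩ := hmem h
      have hcop : (orderOf x).Coprime j := by
        rw [hj, orderOf_pow, hN] at hh
        have hpos : 0 < N := hN ▸ orderOf_pos x
        have := Nat.gcd_dvd_left N j
        rw [hN, Nat.Coprime]
        by_contra hne
        have h0 : 0 < N.gcd j := Nat.gcd_pos_of_pos_left _ hpos
        have := Nat.div_lt_self hpos (show 1 < N.gcd j by omega)
        omega
      obtain ⟨c, hc⟩ := isConj_iff.mp (hG x j hcop)
      have h2 : character (ρ.comp (Subgroup.zpowers x).subtype) h = ρ.character (h : G) := rfl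
      rw [h2, hj, ← hc, char_conj]
    have h2 : ∀ h : Subgroup.zpowers x, orderOf (h : G) ≠ N →
        ∃ q : ℚ, character (ρ.comp (Subgroup.zpowers x).subtype) h = q := by
      intro h hh
      obtain ⟨j, hj⟩ := hmem h
      refine ih (orderOf (h : G)) (lt_of_le_of_ne ?_ hh) (h : G) rfl
      rw [hj, orderOf_pow, hN]
      exact Nat.div_le_self _ _
    choose! q hq using h2
    rw [Finset.sum_congr rfl (fun h hh => h1 h (Finset.mem_filter.mp hh).2), Finset.sum_const,
      Finset.sum_congr rfl (fun h hh => hq h (Finset.mem_filter.mp hh).2), nsmul_eq_mul] at h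
    set s := Finset.univ.filter fun h : Subgroup.zpowers x => orderOf (h : G) = N
    have hs : (s.card : ℂ) ≠ 0 := Nat.cast_ne_zero.mpr (Finset.card_pos.mpr
      ⟨⟨x, Subgroup.mem_zpowers x⟩, Finset.mem_filter.mpr ⟨Finset.mem_univ _, hN⟩⟩).ne'
    refine ⟨(Nat.card (Subgroup.zpowers x) *
      finrank ℂ (invariants (ρ.comp (Subgroup.zpowers x).subtype)) -
      ∑ h ∈ Finset.univ.filter (fun h : Subgroup.zpowers x => ¬ orderOf (h : G) = N), q h) /
      s.card, ?_⟩
    push_cast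
    rw [eq_div_iff hs, ← h]
    ring

theorem Representation.exists_int_character
    (hG : ∀ (x : G) (j : ℕ), (orderOf x).Coprime j → IsConj x (x ^ j))
    (ρ : Representation ℂ G V) (x : G) : ∃ m : ℤ, ρ.character x = m :=
  let ⟨_, hq⟩ := ρ.exists_rat_character hG x
  exists_int_of_isIntegral_of_rat (ρ.isIntegral_character x) hq

/-- χ(x)² − χ(x²) is twice an algebraic integer that is rational, hence an integer; and a² ≡ a mod
2. -/
theorem Representation.exists_character_sq_sub
    (hG : ∀ (x : G) (j : ℕ), (orderOf x).Coprime j → IsConj x (x ^ j))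
    (ρ : Representation ℂ G V) (x : G) :
    ∃ m : ℤ, ρ.character (x ^ 2) - ρ.character x = 2 * m := by
  obtain ⟨M, hM, h1, h2⟩ := ρ.exists_eigenvalues x
  obtain ⟨t, ht, h⟩ := exists_isIntegral_sum_sq M hM
  rw [← h1, ← h2] at h
  obtain ⟨a, ha⟩ := ρ.exists_int_character hG x
  obtain ⟨b, hb⟩ := ρ.exists_int_character hG (x ^ 2)
  rw [ha, hb] at h
  obtain ⟨c, hc⟩ := exists_int_of_isIntegral_of_rat ht (q := ((a : ℚ) ^ 2 - b) / 2)
    (by push_cast; rw [h]; ring)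
  have hab : a ^ 2 - b = 2 * c := by
    rw [hc] at h
    exact_mod_cast h
  obtain ⟨d, hd⟩ : (2 : ℤ) ∣ b - a := by
    have h3 : (2 : ℤ) ∣ a * (a - 1) := (Int.even_mul_pred_self a).two_dvd
    obtain ⟨e, he⟩ := h3
    exact ⟨e - c, by linear_combination he - hab⟩
  refine ⟨d, ?_⟩
  rw [ha, hb]
  exact_mod_cast hd

theorem Representation.exists_character_pow_two_pow_sub
    (hG : ∀ (x : G) (j : ℕ), (orderOf x).Coprime j → IsConj x (x ^ j))
    (ρ : Representation ℂ G V) (x : G) (N : ℕ) :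
    ∃ m : ℤ, ρ.character (x ^ 2 ^ N) - ρ.character x = 2 * m := by
  induction N with
  | zero => exact ⟨0, by simp⟩
  | succ N ih =>
    obtain ⟨a, ha⟩ := ih
    obtain ⟨b, hb⟩ := ρ.exists_character_sq_sub hG (x ^ 2 ^ N)
    refine ⟨a + b, ?_⟩
    rw [pow_succ, pow_mul]
    push_cast
    linear_combination ha + hb

/-- The averages of a character over a subgroup `K` along a commuting subgroup `L` form a character
of `L`. -/
theorem Representation.exists_character_average {H K L : Type} [Group H] [Group K] [Fintype K]
    [Group L] (i : K →* H) (j : L →* H) (hij : ∀ a b, Commute (i a) (j b))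
    (ρ : Representation ℂ H V) :
    ∃ (W : Submodule ℂ V) (τ : Representation ℂ L W), ∀ y,
      τ.character y = (Nat.card K : ℂ)⁻¹ * ∑ u, ρ.character (i u * j y) := by
  have : Invertible (Fintype.card K : ℂ) :=
    invertibleOfNonzero (Nat.cast_ne_zero.mpr Fintype.card_pos.ne')
  -- The vectors fixed by K form an L-stable space, and the trace of y on it is the trace on V of y
  -- composed with the averaging projection.
  let W := invariants (ρ.comp i : Representation ℂ K V)
  have hW : ∀ g, W ≤ W.comap ((ρ.comp j) g) := by
    intro y v hv u
    have h1 : ρ (i u) (ρ (j y) v) = ρ (j y) (ρ (i u) v) := by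
      rw [← Module.End.mul_apply, ← Module.End.mul_apply, ← map_mul, ← map_mul, hij u y]
    exact h1.trans (congrArg (ρ (j y)) (hv u))
  refine ⟨W, subrepresentation (ρ.comp j : Representation ℂ L V) W hW, fun y => ?_⟩
  let P := averageMap (ρ.comp i : Representation ℂ K V)
  have hP : LinearMap.IsProj W P := isProj_averageMap (ρ.comp i)
  have hmem : ∀ v, (ρ (j y) ∘ₗ P) v ∈ W := fun v => hW y (hP.map_mem v)
  have h1 := LinearMap.trace_restrict_eq_of_forall_mem W (ρ (j y) ∘ₗ P) hmem
  have h2 : (ρ (j y) ∘ₗ P).restrict (fun v _ => hmem v) =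
      subrepresentation (ρ.comp j : Representation ℂ L V) W hW y := by
    ext v
    have := hP.map_id v v.2
    simp only [LinearMap.coe_restrict_apply, LinearMap.comp_apply]
    rw [this]
    rfl
  rw [character, ← h2, h1]
  have h3 : P = (Nat.card K : ℂ)⁻¹ • ∑ u, ρ (i u) := by
    simp only [P, averageMap, GroupAlgebra.average, map_smul, map_sum, asAlgebraHom_of]
    rw [Nat.card_eq_fintype_card, invOf_eq_inv]
    rfl
  rw [h3, LinearMap.comp_smul, map_smul, smul_eq_mul]
  congr 1
  have h4 : ρ (j y) ∘ₗ (∑ u, ρ (i u)) = ∑ u, ρ (j y * i u) := by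
    ext v
    simp
  rw [h4, map_sum]
  exact Finset.sum_congr rfl fun u _ => by rw [← hij u y]; rfl

end Integrality

/-! ### Powers of permutations and merging two cycles -/

section PermPowers

open Equiv.Perm

variable {α : Type} [Fintype α] [DecidableEq α]

theorem cycleType_pow_of_coprime (σ : Equiv.Perm α) {j : ℕ} (h : (orderOf σ).Coprime j) :
    (σ ^ j).cycleType = σ.cycleType := by
  induction σ using cycle_induction_on with
  | base_one => simp
  | base_cycles σ hσ =>
    have h1 : (σ ^ j).IsCycle := hσ.pow_iff.mpr h.symm
    rw [h1.cycleType, hσ.cycleType, ← h1.orderOf, ← hσ.orderOf, orderOf_pow, h.gcd_eq_one,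
      Nat.div_one]
  | induction_disjoint σ τ hd hσ h1 h2 =>
    have hlcm : orderOf (σ * τ) = (orderOf σ).lcm (orderOf τ) := hd.orderOf
    rw [hlcm] at h
    rw [hd.commute.mul_pow, (hd.pow_disjoint_pow j j).cycleType_mul, hd.cycleType_mul,
      h1 (h.coprime_dvd_left (Nat.dvd_lcm_left _ _)),
      h2 (h.coprime_dvd_left (Nat.dvd_lcm_right _ _))]

theorem isConj_pow_of_coprime (σ : Equiv.Perm α) (j : ℕ) (h : (orderOf σ).Coprime j) :
    IsConj σ (σ ^ j) :=
  isConj_iff_cycleType_eq.mpr (cycleType_pow_of_coprime σ h).symm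

theorem isConj_inv_perm (σ : Equiv.Perm α) : IsConj σ σ⁻¹ :=
  isConj_iff_cycleType_eq.mpr (cycleType_inv σ).symm

/-- On a moved point x, (h²)^i fixes x exactly when 2k divides 2i, so every cycle of h² has length
k; the size of the support leaves two of them. -/
theorem Equiv.Perm.IsCycle.cycleType_sq {h : Equiv.Perm α} (hh : h.IsCycle) {k : ℕ} (hk : 2 ≤ k)
    (hcard : h.support.card = 2 * k) : (h ^ 2).cycleType = {k, k} := by
  have hord : orderOf h = 2 * k := hh.orderOf.trans hcard
  have hsupp : (h ^ 2).support = h.support := by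
    ext x
    constructor
    · exact fun hx => support_pow_le h 2 hx
    · intro hx
      rw [mem_support]
      intro h2
      rw [← hh.pow_eq_one_iff' (mem_support.mp hx), ← orderOf_dvd_iff_pow_eq_one, hord] at h2
      have := Nat.le_of_dvd (by norm_num) h2
      omega
  have hall : ∀ c ∈ (h ^ 2).cycleType, c = k := by
    intro n hn
    rw [cycleType_def] at hn
    obtain ⟨c, hc, rfl⟩ := Multiset.mem_map.mp hn
    have hc' := mem_cycleFactorsFinset_iff.mp hc
    obtain ⟨x, hx⟩ := hc'.1.nonempty_support
    have hceq : (h ^ 2).cycleOf x = c := (cycle_is_cycleOf hx hc).symm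
    have hxs : h x ≠ x := by
      rw [← mem_support, ← hsupp]
      exact mem_cycleFactorsFinset_support_le hc hx
    have key : ∀ i, orderOf c ∣ i ↔ k ∣ i := by
      intro i
      rw [orderOf_dvd_iff_pow_eq_one, hc'.1.pow_eq_one_iff' (mem_support.mp hx), ← hceq,
        cycleOf_pow_apply_self, ← pow_mul, ← hh.pow_eq_one_iff' hxs,
        ← orderOf_dvd_iff_pow_eq_one, hord]
      exact Nat.mul_dvd_mul_iff_left (by norm_num)
    have : orderOf c = k := Nat.dvd_antisymm ((key k).2 dvd_rfl) ((key _).1 dvd_rfl)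
    simpa [hc'.1.orderOf] using this
  have hrep := Multiset.eq_replicate_of_mem hall
  have hsum := sum_cycleType (h ^ 2)
  rw [hsupp, hcard, hrep, Multiset.sum_replicate, smul_eq_mul] at hsum
  have hc2 : (h ^ 2).cycleType.card = 2 := Nat.eq_of_mul_eq_mul_right (by omega) hsum
  rw [hrep, hc2]
  rfl

/-- Merging two `k`-cycles does not change the conjugacy class of a large `2`-power. -/
theorem exists_isConj_pow_two_pow {v w : Equiv.Perm α} {k : ℕ} (hk : 2 ≤ k) {m : Multiset ℕ}
    (hv : v.cycleType = {k, k} + m) (hw : w.cycleType = {2 * k} + m) :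
    ∃ N : ℕ, IsConj (v ^ 2 ^ N) (w ^ 2 ^ N) := by
  obtain ⟨h, τ, rfl, hd, hh, hcard⟩ := (mem_cycleType_iff (σ := w) (n := 2 * k)).mp (by simp [hw])
  have hτ : τ.cycleType = m := by
    rw [hd.cycleType_mul, hh.cycleType, hcard] at hw
    exact add_left_cancel hw
  have hv' : IsConj v (h ^ 2 * τ) := by
    have hd2 : (h ^ 2).Disjoint τ := by simpa using hd.pow_disjoint_pow 2 1
    rw [isConj_iff_cycleType_eq, hv, hd2.cycleType_mul, hh.cycleType_sq hk hcard, hτ]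
  -- Here w = hτ with h a 2k-cycle, and v is conjugate to h²τ. The power 2^a of h has odd order o,
  -- so squaring it no longer changes the cycle type.
  obtain ⟨a, o, ho, hao⟩ := Nat.exists_eq_two_pow_mul_odd (n := 2 * k) (by omega)
  refine ⟨a, ?_⟩
  obtain ⟨c, hc⟩ := isConj_iff.mp hv'
  have h1 : IsConj (v ^ 2 ^ a) ((h ^ 2 * τ) ^ 2 ^ a) := isConj_iff.mpr ⟨c, by rw [← hc, conj_pow]⟩
  refine h1.trans (isConj_iff_cycleType_eq.mpr ?_)
  have hcomm : Commute (h ^ 2) τ := hd.commute.pow_left 2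
  have hord : (orderOf (h ^ 2 ^ a)).Coprime 2 := by
    have : orderOf h = 2 ^ a * o := by rw [hh.orderOf, hcard, hao]
    rw [orderOf_pow, this, Nat.gcd_mul_right_left, Nat.mul_div_cancel_left _ (by positivity)]
    exact Nat.coprime_two_right.mpr ho
  rw [hcomm.mul_pow, hd.commute.mul_pow, ← pow_mul, mul_comm 2, pow_mul]
  have hd3 : ((h ^ 2 ^ a) ^ 2).Disjoint (τ ^ 2 ^ a) := by
    rw [← pow_mul]
    exact hd.pow_disjoint_pow _ _
  rw [hd3.cycleType_mul, (hd.pow_disjoint_pow _ _).cycleType_mul, cycleType_pow_of_coprime _ hord]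

theorem disjoint_ofSubtype {β : Type*} (p : β → Prop) [DecidablePred p]
    (u : Equiv.Perm {x // p x}) (v : Equiv.Perm {x // ¬ p x}) :
    (ofSubtype u).Disjoint (ofSubtype v) := by
  intro x
  by_cases hx : p x
  · exact Or.inr (ofSubtype_apply_of_not_mem v (not_not.mpr hx))
  · exact Or.inl (ofSubtype_apply_of_not_mem u hx)

/-- The averages are values at v and w of one character of the complementary symmetric group. Each
is congruent mod 2 to the value at a 2-power, and those powers are conjugate. -/
theorem exists_int_average_sub (p : α → Prop) [DecidablePred p] {v w : Equiv.Perm {x // ¬ p x}}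
    {k : ℕ} (hk : 2 ≤ k) {m : Multiset ℕ} (hv : v.cycleType = {k, k} + m)
    (hw : w.cycleType = {2 * k} + m) {V : Type} [AddCommGroup V] [Module ℂ V]
    [FiniteDimensional ℂ V] (ρ : Representation ℂ (Equiv.Perm α) V) :
    ∃ c : ℤ, (Nat.card (Equiv.Perm {x // p x}) : ℂ)⁻¹ *
      ∑ u : Equiv.Perm {x // p x}, ρ.character (ofSubtype u * ofSubtype v) -
      (Nat.card (Equiv.Perm {x // p x}) : ℂ)⁻¹ *
      ∑ u : Equiv.Perm {x // p x}, ρ.character (ofSubtype u * ofSubtype w) = 2 * c := by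
  obtain ⟨W, τ, hτ⟩ := ρ.exists_character_average (ofSubtype (p := p))
    (ofSubtype (p := fun x => ¬ p x)) fun a b => (disjoint_ofSubtype p a b).commute
  obtain ⟨N, hN⟩ := exists_isConj_pow_two_pow hk hv hw
  obtain ⟨a, ha⟩ := τ.exists_character_pow_two_pow_sub isConj_pow_of_coprime v N
  obtain ⟨b, hb⟩ := τ.exists_character_pow_two_pow_sub isConj_pow_of_coprime w N
  obtain ⟨d, hd⟩ := isConj_iff.mp hN
  rw [← hd, char_conj] at hb
  refine ⟨b - a, ?_⟩
  rw [← hτ, ← hτ]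
  push_cast
  linear_combination hb - ha

end PermPowers

/-! ### Class functions counting conjugators -/

section ClassFunctions

variable {G : Type} [Group G] [Fintype G] [DecidableEq G]

/-- The number of elements conjugating `x` to `t`. -/
def conjugators (x t : G) : ℕ := (Finset.univ.filter fun a : G => a * x * a⁻¹ = t).card

theorem conjugators_conj (b x t : G) : conjugators (b * x * b⁻¹) t = conjugators x t := by
  refine Finset.card_bij' (fun a _ => a * b) (fun a _ => a * b⁻¹) ?_ ?_ ?_ ?_
  · intro a ha
    simp only [Finset.mem_filter, Finset.mem_univ, true_and] at ha ⊢
    rw [← ha]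
    group
  · intro a ha
    simp only [Finset.mem_filter, Finset.mem_univ, true_and] at ha ⊢
    rw [← ha]
    group
  · intro a _
    group
  · intro a _
    group

/-- Each a in G contributes f(a⁻¹ta) = f(t). Thus pairing with the conjugator count evaluates a
class function at t. -/
theorem sum_conjugators_mul (t : G) (f : G → ℂ) (hf : ∀ a x, f (a * x * a⁻¹) = f x) :
    ∑ x, (conjugators x t : ℂ) * f x = Nat.card G * f t := by
  have h1 : ∀ x, (conjugators x t : ℂ) * f x = ∑ a : G, if x = a⁻¹ * t * a then f x else 0 := by
    intro x
    rw [conjugators, Finset.card_filter, Nat.cast_sum, Finset.sum_mul]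
    refine Finset.sum_congr rfl fun a _ => ?_
    have : a * x * a⁻¹ = t ↔ x = a⁻¹ * t * a := by
      constructor
      · rintro rfl
        group
      · rintro rfl
        group
    by_cases h : a * x * a⁻¹ = t
    · rw [if_pos h, if_pos (this.1 h)]
      simp
    · rw [if_neg h, if_neg fun h' => h (this.2 h')]
      simp
  rw [Finset.sum_congr rfl fun x _ => h1 x, Finset.sum_comm]
  have h2 : ∀ a : G, (∑ x, if x = a⁻¹ * t * a then f x else 0) = f t := by
    intro a
    rw [Finset.sum_ite_eq' Finset.univ (a⁻¹ * t * a) f, if_pos (Finset.mem_univ _)]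
    simpa using hf a⁻¹ t
  rw [Finset.sum_congr rfl fun a _ => h2 a, Finset.sum_const, Finset.card_univ,
    Nat.card_eq_fintype_card, nsmul_eq_mul]

theorem virtualCharacters_restrict {G : Type} [Group G] [Finite G] {ψ : G → ℂ}
    (hψ : ψ ∈ virtualCharacters G) (H : Subgroup G) :
    (fun h : H => ψ h) ∈ virtualCharacters H := by
  induction hψ using Submodule.span_induction with
  | mem χ hχ =>
    obtain ⟨V, _, _, _, ρ, -, rfl⟩ := hχ
    exact character_mem_virtualCharacters V (ρ.comp H.subtype)
  | zero => exact zero_mem _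
  | add f f' _ _ h h' => exact add_mem h h'
  | smul c f _ h => exact Submodule.smul_mem _ c h

end ClassFunctions

/-! ### Centralizer orders of products over a block -/

section Centralizers

open Equiv.Perm Nat

/-- The product of the factorials of the multiplicities of a multiset. -/
def multFactorial (c : Multiset ℕ) : ℕ := ∏ i ∈ c.toFinset, (c.count i)!

theorem multFactorial_eq_prod {c : Multiset ℕ} {s : Finset ℕ} (h : c.toFinset ⊆ s) :
    multFactorial c = ∏ i ∈ s, (c.count i)! :=
  Finset.prod_subset h fun i _ hi => by
    rw [Multiset.count_eq_zero_of_notMem (by simpa using hi), factorial_zero]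

theorem multFactorial_pos (c : Multiset ℕ) : 0 < multFactorial c :=
  Finset.prod_pos fun _ _ => factorial_pos _

theorem multFactorial_add_of_disjoint {c d : Multiset ℕ} (h : ∀ i ∈ c, i ∉ d) :
    multFactorial (c + d) = multFactorial c * multFactorial d := by
  have hc : c.toFinset ⊆ (c + d).toFinset := by
    rw [Multiset.toFinset_add]; exact Finset.subset_union_left
  have hd : d.toFinset ⊆ (c + d).toFinset := by
    rw [Multiset.toFinset_add]; exact Finset.subset_union_right
  rw [multFactorial_eq_prod hc, multFactorial_eq_prod hd, multFactorial, ← Finset.prod_mul_distrib]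
  refine Finset.prod_congr rfl fun i _ => ?_
  rw [Multiset.count_add]
  by_cases hi : i ∈ c
  · rw [Multiset.count_eq_zero_of_notMem (h i hi)]; simp
  · rw [Multiset.count_eq_zero_of_notMem hi]; simp

theorem multFactorial_singleton (b : ℕ) : multFactorial {b} = 1 := by
  simp [multFactorial]

theorem multFactorial_singleton_add (b : ℕ) (c : Multiset ℕ) :
    multFactorial ({b} + c) = multFactorial c * (c.count b + 1) := by
  have h : c.toFinset ⊆ insert b c.toFinset := Finset.subset_insert _ _
  have h' : ({b} + c).toFinset ⊆ insert b c.toFinset := by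
    intro i; simp
  have hb : b ∈ insert b c.toFinset := Finset.mem_insert_self _ _
  rw [multFactorial_eq_prod h, multFactorial_eq_prod h', ← Finset.mul_prod_erase _ _ hb,
    ← Finset.mul_prod_erase _ (fun i => (c.count i)!) hb, Finset.prod_congr rfl fun i hi => ?_]
  · simp only [Multiset.count_add, Multiset.count_singleton_self]
    rw [add_comm 1, factorial_succ]
    ring
  · rw [Multiset.count_add, Multiset.count_singleton, if_neg (Finset.ne_of_mem_erase hi), zero_add]

variable {α : Type} [Fintype α] [DecidableEq α]

/-- The order of the centralizer of a permutation. -/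
def centralizerOrder (σ : Equiv.Perm α) : ℕ :=
  (σ.supportᶜ.card)! * σ.cycleType.prod * multFactorial σ.cycleType

theorem centralizerOrder_pos (σ : Equiv.Perm α) : 0 < centralizerOrder σ := by
  have : 0 < σ.cycleType.prod :=
    Multiset.prod_pos fun i hi => zero_lt_two.trans_le (two_le_of_mem_cycleType hi)
  have := multFactorial_pos σ.cycleType
  have := factorial_pos σ.supportᶜ.card
  unfold centralizerOrder
  positivity

theorem conjugators_self (σ : Equiv.Perm α) : conjugators σ σ = centralizerOrder σ := by
  classical
  have h := nat_card_centralizer σ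
  rw [sum_cycleType, ← Finset.card_compl] at h
  rw [centralizerOrder, multFactorial, ← h, conjugators, Nat.card_eq_fintype_card,
    Fintype.card_subtype]
  congr 1
  ext a
  simp only [Finset.mem_filter, Finset.mem_univ, true_and, Subgroup.mem_centralizer_singleton_iff]
  rw [mul_inv_eq_iff_eq_mul]

theorem conjugators_eq (σ τ : Equiv.Perm α) : conjugators σ τ =
    if σ.cycleType = τ.cycleType then centralizerOrder τ else 0 := by
  split_ifs with h
  · obtain ⟨c, rfl⟩ := isConj_iff.mp (isConj_iff_cycleType_eq.mpr h)
    rw [← conjugators_self, conjugators_conj]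
  · refine Finset.card_eq_zero.mpr (Finset.filter_eq_empty_iff.mpr fun a _ ha => h ?_)
    exact isConj_iff_cycleType_eq.mp (isConj_iff.mpr ⟨a, ha⟩)

theorem card_cycleType_eq_mul (σ : Equiv.Perm α) :
    (Finset.univ.filter fun τ : Equiv.Perm α => τ.cycleType = σ.cycleType).card *
      centralizerOrder σ = Nat.card (Equiv.Perm α) := by
  have h := card_of_cycleType_mul_eq α σ.cycleType
  have hle : σ.cycleType.sum ≤ Fintype.card α := by
    rw [sum_cycleType]; exact Finset.card_le_univ _
  rw [if_pos ⟨hle, fun _ => two_le_of_mem_cycleType⟩] at h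
  rw [Nat.card_eq_fintype_card, Fintype.card_perm, ← h, centralizerOrder, multFactorial,
    Finset.card_compl, sum_cycleType]

variable (p : α → Prop) [DecidablePred p]

theorem cycleType_ofSubtype_mul (u : Equiv.Perm {x // p x}) (v : Equiv.Perm {x // ¬ p x}) :
    (ofSubtype u * ofSubtype v).cycleType = u.cycleType + v.cycleType := by
  rw [(disjoint_ofSubtype p u v).cycleType_mul, cycleType_ofSubtype, cycleType_ofSubtype]

theorem card_compl_support_ofSubtype_mul (u : Equiv.Perm {x // p x})
    (v : Equiv.Perm {x // ¬ p x}) : (ofSubtype u * ofSubtype v).supportᶜ.card =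
      u.supportᶜ.card + v.supportᶜ.card := by
  have h1 := cycleType_ofSubtype_mul p u v
  have h2 := congrArg Multiset.sum h1
  rw [Multiset.sum_add, sum_cycleType, sum_cycleType, sum_cycleType] at h2
  have h3 := Fintype.card_subtype_compl p
  have h4 := Fintype.card_subtype_le p
  have h5 := Finset.card_le_univ u.support
  have h6 := Finset.card_le_univ v.support
  rw [Finset.card_compl, Finset.card_compl, Finset.card_compl]
  omega

/-- The quotient of the centralizer orders of `u * x` and of `u`. -/
def centralizerRatio (u : Equiv.Perm {x // p x}) (x : Equiv.Perm {x // ¬ p x}) : ℕ :=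
  centralizerOrder x * (1 + x.supportᶜ.card * u.supportᶜ.card) *
    (if u.cycleType = {Fintype.card {x // p x}} then
      1 + x.cycleType.count (Fintype.card {x // p x}) else 1)

/-- The two cycle types can share only the length b of the whole block, and then u is a single
b-cycle, which multiplies the factorials by 1 + count. Fixed points give (f + e)! = f! e! (1 + ef),
valid as e ≤ 1. -/
theorem centralizerOrder_ofSubtype_mul (u : Equiv.Perm {x // p x}) (x : Equiv.Perm {x // ¬ p x})
    (hx : ∀ c ∈ x.cycleType, Fintype.card {x // p x} ≤ c) (he : x.supportᶜ.card ≤ 1) :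
    centralizerOrder (ofSubtype u * ofSubtype x) = centralizerOrder u * centralizerRatio p u x := by
  have hfact : (u.supportᶜ.card + x.supportᶜ.card)! =
      u.supportᶜ.card ! * x.supportᶜ.card ! * (1 + x.supportᶜ.card * u.supportᶜ.card) := by
    interval_cases x.supportᶜ.card
    · simp
    · simp only [factorial_succ, factorial_zero]; ring
  have hmult : multFactorial (u.cycleType + x.cycleType) =
      multFactorial u.cycleType * multFactorial x.cycleType *
      (if u.cycleType = {Fintype.card {x // p x}} then
      1 + x.cycleType.count (Fintype.card {x // p x}) else 1) := by
    split_ifs with h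
    · rw [h, multFactorial_singleton_add, multFactorial_singleton]
      ring
    · rw [mul_one]
      refine multFactorial_add_of_disjoint fun i hi hi' => h ?_
      obtain ⟨t, ht⟩ := Multiset.exists_cons_of_mem hi
      have hsum := sum_cycleType u
      have hle := Finset.card_le_univ u.support
      rw [ht, Multiset.sum_cons] at hsum
      have hib := hx i hi'
      have ht0 : t = 0 := by
        rw [Multiset.eq_zero_iff_forall_notMem]
        intro j hj
        have h2 : 2 ≤ j := two_le_of_mem_cycleType (σ := u) (by rw [ht]; simp [hj])
        have h3 := Multiset.le_sum_of_mem hj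
        omega
      rw [ht, ht0]
      simp only [Multiset.cons_zero, Multiset.singleton_inj]
      omega
  rw [centralizerOrder, card_compl_support_ofSubtype_mul, cycleType_ofSubtype_mul, hfact, hmult,
    Multiset.prod_add, centralizerRatio, centralizerOrder, centralizerOrder]
  ring

/-- Only u' of the cycle type of u contribute, and their number times the centralizer order of u is
the order of the block group. -/
theorem sum_conjugators_ofSubtype (u : Equiv.Perm {x // p x}) (x : Equiv.Perm {x // ¬ p x})
    (hx : ∀ c ∈ x.cycleType, Fintype.card {x // p x} ≤ c) (he : x.supportᶜ.card ≤ 1) :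
    ∑ u' : Equiv.Perm {x // p x}, conjugators (ofSubtype u * ofSubtype x)
      (ofSubtype u' * ofSubtype x) =
      Nat.card (Equiv.Perm {x // p x}) * centralizerRatio p u x := by
  have h1 : ∀ u' : Equiv.Perm {x // p x}, conjugators (ofSubtype u * ofSubtype x)
      (ofSubtype u' * ofSubtype x) = if u'.cycleType = u.cycleType then
        centralizerOrder (ofSubtype u * ofSubtype x) else 0 := by
    intro u'
    simp only [conjugators_eq, cycleType_ofSubtype_mul, add_left_inj]
    by_cases h : u.cycleType = u'.cycleType
    · rw [if_pos h, if_pos h.symm, centralizerOrder, centralizerOrder,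
        card_compl_support_ofSubtype_mul, card_compl_support_ofSubtype_mul,
        cycleType_ofSubtype_mul, cycleType_ofSubtype_mul, Finset.card_compl u.support,
        Finset.card_compl u'.support, ← sum_cycleType, ← sum_cycleType, h]
    · rw [if_neg h, if_neg fun h' => h h'.symm]
  rw [Finset.sum_congr rfl fun u' _ => h1 u', ← Finset.sum_filter, Finset.sum_const, smul_eq_mul,
    centralizerOrder_ofSubtype_mul p u x hx he, ← mul_assoc, card_cycleType_eq_mul]

end Centralizers

/-! ### Sums over permutations of a given sign -/

section SignSums

open Equiv Equiv.Perm Nat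

variable {β : Type} [Fintype β] [DecidableEq β]

/-- Right multiplication by the transposition exchanges the two signs and preserves f. -/
theorem sum_sign_eq_of_mul_swap {f : Equiv.Perm β → ℕ} {a b : β} (hab : a ≠ b)
    (hf : ∀ σ, f (σ * swap a b) = f σ) (ε : ℤˣ) :
    2 * ∑ σ ∈ Finset.univ.filter (fun σ : Equiv.Perm β => sign σ = ε), f σ = ∑ σ, f σ := by
  have h : ∑ σ ∈ Finset.univ.filter (fun σ : Equiv.Perm β => ¬ sign σ = ε), f σ =
      ∑ σ ∈ Finset.univ.filter (fun σ : Equiv.Perm β => sign σ = ε), f σ := by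
    refine Finset.sum_bij' (fun σ _ => σ * swap a b) (fun σ _ => σ * swap a b) ?_ ?_ ?_ ?_ ?_
    · intro σ hσ
      simp only [Finset.mem_filter, Finset.mem_univ, true_and, Perm.sign_mul, sign_swap hab] at hσ ⊢
      rcases Int.units_eq_one_or (sign σ) with h | h <;>
        rcases Int.units_eq_one_or ε with h' | h' <;> simp_all
    · intro σ hσ
      simp only [Finset.mem_filter, Finset.mem_univ, true_and, Perm.sign_mul, sign_swap hab] at hσ ⊢
      rcases Int.units_eq_one_or (sign σ) with h | h <;>
        rcases Int.units_eq_one_or ε with h' | h' <;> simp_all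
    · intro σ _
      simp [mul_assoc]
    · intro σ _
      simp [mul_assoc]
    · intro σ _
      exact (hf σ).symm
  rw [← Finset.sum_filter_add_sum_filter_not Finset.univ (fun σ : Equiv.Perm β => sign σ = ε), h]
  ring

theorem two_mul_card_sign_eq (hβ : 2 ≤ Fintype.card β) (ε : ℤˣ) :
    2 * (Finset.univ.filter (fun σ : Equiv.Perm β => sign σ = ε)).card =
      Nat.card (Equiv.Perm β) := by
  obtain ⟨a, b, hab⟩ := Fintype.exists_pair_of_one_lt_card hβ
  have := sum_sign_eq_of_mul_swap (f := fun _ => 1) hab (fun _ => rfl) ε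
  simpa [Nat.card_eq_fintype_card] using this

/-- By Burnside the average number of fixed points is 1. For each x a transposition avoiding x,
available from three points on, balances the signs among the permutations fixing x. -/
theorem two_mul_sum_sign_card_fixed (hβ : 3 ≤ Fintype.card β) (ε : ℤˣ) :
    2 * ∑ σ ∈ Finset.univ.filter (fun σ : Equiv.Perm β => sign σ = ε), σ.supportᶜ.card =
      Nat.card (Equiv.Perm β) := by
  classical
  have hfix : ∀ σ : Equiv.Perm β, σ.supportᶜ.card = ∑ x : β, if σ x = x then 1 else 0 := by
    intro σ
    rw [Finset.sum_boole, Nat.cast_id]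
    congr 1
    ext x
    simp
  have h1 : ∀ x : β, 2 * ∑ σ ∈ Finset.univ.filter (fun σ : Equiv.Perm β => sign σ = ε),
      (if σ x = x then 1 else 0) = ∑ σ : Equiv.Perm β, if σ x = x then 1 else 0 := by
    intro x
    have hcard : 1 < (Finset.univ.erase x).card := by
      rw [Finset.card_erase_of_mem (Finset.mem_univ _), Finset.card_univ]
      omega
    obtain ⟨a, ha, b, hb, hab⟩ := Finset.one_lt_card.mp hcard
    refine sum_sign_eq_of_mul_swap hab (fun σ => ?_) ε
    rw [Perm.mul_apply, swap_apply_of_ne_of_ne (Finset.ne_of_mem_erase ha).symm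
      (Finset.ne_of_mem_erase hb).symm]
  have h2 : ∑ σ : Equiv.Perm β, σ.supportᶜ.card = Nat.card (Equiv.Perm β) := by
    have hB := MulAction.sum_card_fixedBy_eq_card_orbits_mul_card_group (Equiv.Perm β) β
    have : Nonempty β := Fintype.card_pos_iff.mp (by omega)
    have horb : Fintype.card (Quotient (MulAction.orbitRel (Equiv.Perm β) β)) = 1 :=
      Fintype.card_eq_one_iff.mpr ⟨Quotient.mk _ (Classical.arbitrary β), fun q => by
        induction q using Quotient.inductionOn with
        | _ x =>
          refine Quotient.sound (s := MulAction.orbitRel (Equiv.Perm β) β)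
            ⟨swap (Classical.arbitrary β) x, ?_⟩
          simp⟩
    rw [horb, one_mul] at hB
    rw [Nat.card_eq_fintype_card, ← hB]
    refine Finset.sum_congr rfl fun σ _ => ?_
    rw [Fintype.card_subtype]
    congr 1
    ext x
    simp
  rw [← h2]
  simp_rw [hfix]
  rw [Finset.sum_comm, Finset.mul_sum, Finset.sum_congr rfl fun x _ => h1 x, Finset.sum_comm]

end SignSums

/-! ### The block function as a virtual character -/

section BlockFunction

open Equiv.Perm Nat

variable {α : Type} [Fintype α] [DecidableEq α] (p : α → Prop) [DecidablePred p]
  (v w : Equiv.Perm {x // ¬ p x})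

/-- Half the difference of the averages over `u ∈ Perm {x // p x}` of the functions counting
conjugators to `u * v` and to `u * w`. -/
noncomputable def blockFunction (x : Equiv.Perm α) : ℝ :=
  (2 * Nat.card (Equiv.Perm {x // p x}) : ℝ)⁻¹ *
    (∑ u : Equiv.Perm {x // p x}, (conjugators x (ofSubtype u * ofSubtype v) : ℝ) -
      ∑ u : Equiv.Perm {x // p x}, (conjugators x (ofSubtype u * ofSubtype w) : ℝ))

theorem blockFunction_conj (a x : Equiv.Perm α) :
    blockFunction p v w (a * x * a⁻¹) = blockFunction p v w x := by
  simp only [blockFunction, conjugators_conj]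

theorem sum_blockFunction_mul (f : Equiv.Perm α → ℂ) (hf : ∀ a x, f (a * x * a⁻¹) = f x) :
    ∑ x, (blockFunction p v w x : ℂ) * f x =
      (2 * Nat.card (Equiv.Perm {x // p x}) : ℂ)⁻¹ * (Nat.card (Equiv.Perm α) *
        (∑ u : Equiv.Perm {x // p x}, f (ofSubtype u * ofSubtype v) -
          ∑ u : Equiv.Perm {x // p x}, f (ofSubtype u * ofSubtype w))) := by
  have h : ∀ y : Equiv.Perm {x // ¬ p x}, ∑ x, (∑ u : Equiv.Perm {x // p x},
      (conjugators x (ofSubtype u * ofSubtype y) : ℂ)) * f x =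
      Nat.card (Equiv.Perm α) * ∑ u : Equiv.Perm {x // p x}, f (ofSubtype u * ofSubtype y) := by
    intro y
    simp_rw [Finset.sum_mul]
    rw [Finset.sum_comm, Finset.mul_sum]
    exact Finset.sum_congr rfl fun u _ => sum_conjugators_mul _ f hf
  rw [mul_sub, ← h v, ← h w, ← Finset.sum_sub_distrib, Finset.mul_sum]
  refine Finset.sum_congr rfl fun x _ => ?_
  rw [blockFunction]
  push_cast
  ring

/-- Its multiplicity in χ is half the difference of the averages of χ over uv and over uw, an
integer by the congruence mod 2. -/
theorem blockFunction_mem_virtualCharacters {v w} {k : ℕ} (hk : 2 ≤ k) {m : Multiset ℕ}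
    (hv : v.cycleType = {k, k} + m) (hw : w.cycleType = {2 * k} + m) :
    (fun x => (blockFunction p v w x : ℂ)) ∈ virtualCharacters (Equiv.Perm α) := by
  refine mem_virtualCharacters_of_charForm (fun a x => by rw [blockFunction_conj]) ?_
  rintro χ ⟨V, _, _, _, ρ, -, rfl⟩
  obtain ⟨c, hc⟩ := exists_int_average_sub p hk hv hw ρ
  refine ⟨c, ?_⟩
  have hinv : ∀ x, ρ.character x⁻¹ = ρ.character x := fun x => by
    obtain ⟨a, ha⟩ := isConj_iff.mp (isConj_inv_perm x)
    rw [← ha, char_conj]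
  rw [charForm]
  simp only [hinv]
  rw [sum_blockFunction_mul p v w _ (fun a x => char_conj ρ x a), mul_inv]
  have hS : (Nat.card (Equiv.Perm α) : ℂ) ≠ 0 := Nat.cast_ne_zero.mpr Nat.card_pos.ne'
  have h2 : (2 : ℂ)⁻¹ * 2 = 1 := by norm_num
  linear_combination (2 : ℂ)⁻¹ * hc + c * h2 +
    ((2 : ℂ)⁻¹ * (Nat.card (Equiv.Perm {x // p x}) : ℂ)⁻¹ *
      (∑ u : Equiv.Perm {x // p x}, ρ.character (ofSubtype u * ofSubtype v) -
        ∑ u : Equiv.Perm {x // p x}, ρ.character (ofSubtype u * ofSubtype w))) *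
      (inv_mul_cancel₀ hS)

theorem sign_conj {β : Type*} [Fintype β] [DecidableEq β] (a x : Equiv.Perm β) :
    sign (a * x * a⁻¹) = sign x := by
  rw [Equiv.Perm.sign_mul, Equiv.Perm.sign_mul, sign_inv, mul_right_comm, Int.units_mul_self,
    one_mul]

/-- The pairing formula is applied to the function itself cut off outside A_n; the index 2 of A_n
cancels the factor 1/2. -/
theorem charForm_blockFunction [Nontrivial α] :
    charForm (fun h : alternatingGroup α => (blockFunction p v w h : ℂ))
      (fun h : alternatingGroup α => (blockFunction p v w h : ℂ)) =
    (((Nat.card (Equiv.Perm {x // p x}) : ℝ)⁻¹ *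
      (∑ u : Equiv.Perm {x // p x}, (if sign u = sign v then
          blockFunction p v w (ofSubtype u * ofSubtype v) else 0) -
        ∑ u : Equiv.Perm {x // p x}, (if sign u = sign w then
          blockFunction p v w (ofSubtype u * ofSubtype w) else 0)) : ℝ) : ℂ) := by
  have hinv : ∀ x, blockFunction p v w x⁻¹ = blockFunction p v w x := fun x => by
    obtain ⟨a, ha⟩ := isConj_iff.mp (isConj_inv_perm x)
    rw [← ha, blockFunction_conj]
  have hsign : ∀ (u : Equiv.Perm {x // p x}) (x : Equiv.Perm {x // ¬ p x}),
      sign (ofSubtype u * ofSubtype x) = 1 ↔ sign u = sign x := by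
    intro u x
    rw [Equiv.Perm.sign_mul, sign_ofSubtype, sign_ofSubtype]
    rcases Int.units_eq_one_or (sign u) with h | h <;>
      rcases Int.units_eq_one_or (sign x) with h' | h' <;> simp [h, h']
  let f : Equiv.Perm α → ℂ := fun x => if sign x = 1 then (blockFunction p v w x : ℂ) else 0
  have hf : ∀ a x, f (a * x * a⁻¹) = f x := fun a x => by
    simp only [f, blockFunction_conj]
    rw [sign_conj]
  have hA : (Nat.card (Equiv.Perm α) : ℂ) = 2 * Nat.card (alternatingGroup α) := by
    rw [Nat.card_eq_fintype_card, Nat.card_eq_fintype_card, ← two_mul_card_alternatingGroup]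
    push_cast
    rfl
  have hA0 : (Nat.card (alternatingGroup α) : ℂ) ≠ 0 := Nat.cast_ne_zero.mpr Nat.card_pos.ne'
  have hsum : ∑ h : alternatingGroup α, (blockFunction p v w h : ℂ) *
      (blockFunction p v w (h⁻¹ : alternatingGroup α) : ℂ) =
      ∑ x, (blockFunction p v w x : ℂ) * f x := by
    simp only [f, mul_ite, mul_zero]
    rw [← Finset.sum_filter, Finset.sum_subtype (p := fun x => x ∈ alternatingGroup α)]
    · refine Finset.sum_congr rfl fun h _ => ?_
      rw [InvMemClass.coe_inv, hinv]
    · intro x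
      simp [mem_alternatingGroup]
  rw [charForm, hsum, sum_blockFunction_mul p v w f hf, hA]
  simp only [f, hsign]
  push_cast
  rw [mul_inv]
  have h2 : (2 : ℂ)⁻¹ * 2 = 1 := by norm_num
  field_simp
  congr 1 <;> exact Finset.sum_congr rfl fun u _ => by split_ifs <;> simp

end BlockFunction

/-! ### Bounds for the value and norm of the block function -/

section BlockBounds

open Equiv.Perm Nat

variable {α : Type} [Fintype α] [DecidableEq α]

/-- The common factor T also absorbs one k: the two k-cycles contribute k² to the product of lengths
and the 2k-cycle contributes 2k. -/
theorem centralizerOrder_merge {β : Type} [Fintype β] [DecidableEq β] {v w : Equiv.Perm β} {k : ℕ}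
    {m : Multiset ℕ} (hv : v.cycleType = {k, k} + m) (hw : w.cycleType = {2 * k} + m) :
    ∃ T : ℕ, centralizerOrder v = T * (k * (m.count k + 1) * (m.count k + 2)) ∧
      centralizerOrder w = T * (2 * (m.count (2 * k) + 1)) := by
  have hfix : w.supportᶜ.card = v.supportᶜ.card := by
    rw [Finset.card_compl, Finset.card_compl, ← sum_cycleType, ← sum_cycleType, hv, hw]
    simp only [Multiset.sum_add, Multiset.sum_singleton, Multiset.insert_eq_cons,
      Multiset.sum_cons]
    congr 2
    ring
  have hv' : v.cycleType = {k} + ({k} + m) := by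
    rw [hv, ← add_assoc]
    rfl
  refine ⟨v.supportᶜ.card ! * m.prod * multFactorial m * k, ?_, ?_⟩
  · rw [centralizerOrder, hv', multFactorial_singleton_add, multFactorial_singleton_add]
    simp only [Multiset.prod_add, Multiset.prod_singleton, Multiset.count_add,
      Multiset.count_singleton_self]
    ring
  · rw [centralizerOrder, hfix, hw, multFactorial_singleton_add]
    simp only [Multiset.prod_add, Multiset.prod_singleton]
    ring

theorem card_compl_support_of_cycleType_eq_singleton {β : Type} [Fintype β] [DecidableEq β]
    {u : Equiv.Perm β} {l : ℕ} (hu : u.cycleType = {l}) :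
    u.supportᶜ.card = Fintype.card β - l := by
  rw [Finset.card_compl, ← sum_cycleType, hu, Multiset.sum_singleton]

theorem card_cycleType_eq_card_mul {β : Type} [Fintype β] [DecidableEq β]
    (hβ : 2 ≤ Fintype.card β) :
    (Finset.univ.filter (fun u : Equiv.Perm β => u.cycleType = {Fintype.card β})).card *
      Fintype.card β = Nat.card (Equiv.Perm β) := by
  rw [card_of_cycleType_singleton hβ le_rfl, Nat.choose_self, mul_one, mul_comm,
    Nat.mul_factorial_pred (by omega), Nat.card_eq_fintype_card, Fintype.card_perm]

theorem two_mul_sum_sign_one_add {β : Type} [Fintype β] [DecidableEq β]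
    (hβ : 2 ≤ Fintype.card β) {e : ℕ} (he : e = 0 ∨ (e = 1 ∧ 3 ≤ Fintype.card β)) (ε : ℤˣ) :
    2 * ∑ u ∈ Finset.univ.filter (fun u : Equiv.Perm β => sign u = ε),
      (1 + e * u.supportᶜ.card) = Nat.card (Equiv.Perm β) * (1 + e) := by
  have h1 := two_mul_card_sign_eq hβ ε
  rcases he with rfl | ⟨rfl, h3⟩
  · simpa using h1
  · have h2 := two_mul_sum_sign_card_fixed h3 ε
    simp only [one_mul]
    rw [Finset.sum_add_distrib, Finset.sum_const, smul_eq_mul, mul_one]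
    omega

variable (p : α → Prop) [DecidablePred p] {v w : Equiv.Perm {x // ¬ p x}}

theorem blockFunction_le (hv : ∀ c ∈ v.cycleType, Fintype.card {x // p x} ≤ c)
    (he : v.supportᶜ.card ≤ 1) (u : Equiv.Perm {x // p x}) :
    blockFunction p v w (ofSubtype u * ofSubtype v) ≤ centralizerRatio p u v / 2 := by
  have h1 : ∑ u' : Equiv.Perm {x // p x}, (conjugators (ofSubtype u * ofSubtype v)
      (ofSubtype u' * ofSubtype v) : ℝ) =
      Nat.card (Equiv.Perm {x // p x}) * centralizerRatio p u v := by
    exact_mod_cast sum_conjugators_ofSubtype p u v hv he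
  have h2 : (0 : ℝ) ≤ ∑ u' : Equiv.Perm {x // p x}, (conjugators (ofSubtype u * ofSubtype v)
      (ofSubtype u' * ofSubtype w) : ℝ) := Finset.sum_nonneg fun _ _ => Nat.cast_nonneg _
  have h0 : (0 : ℝ) < Nat.card (Equiv.Perm {x // p x}) := Nat.cast_pos.mpr Nat.card_pos
  rw [blockFunction, h1, inv_mul_le_iff₀ (by positivity)]
  linarith

theorem neg_le_blockFunction (hw : ∀ c ∈ w.cycleType, Fintype.card {x // p x} ≤ c)
    (he : w.supportᶜ.card ≤ 1) (u : Equiv.Perm {x // p x}) :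
    -(centralizerRatio p u w / 2 : ℝ) ≤ blockFunction p v w (ofSubtype u * ofSubtype w) := by
  have h1 : ∑ u' : Equiv.Perm {x // p x}, (conjugators (ofSubtype u * ofSubtype w)
      (ofSubtype u' * ofSubtype w) : ℝ) =
      Nat.card (Equiv.Perm {x // p x}) * centralizerRatio p u w := by
    exact_mod_cast sum_conjugators_ofSubtype p u w hw he
  have h2 : (0 : ℝ) ≤ ∑ u' : Equiv.Perm {x // p x}, (conjugators (ofSubtype u * ofSubtype w)
      (ofSubtype u' * ofSubtype v) : ℝ) := Finset.sum_nonneg fun _ _ => Nat.cast_nonneg _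
  have h0 : (0 : ℝ) < Nat.card (Equiv.Perm {x // p x}) := Nat.cast_pos.mpr Nat.card_pos
  rw [blockFunction, h1, le_inv_mul_iff₀ (by positivity)]
  linarith

/-- Equal cycle types would force u to contain two k-cycles, impossible in a block of at most k
points. So the w-part of the block function vanishes at u₀v. -/
theorem conjugators_merge_eq_zero {k : ℕ} {m : Multiset ℕ} (hk : 2 ≤ k)
    (hbk : Fintype.card {x // p x} ≤ k) (hv : v.cycleType = {k, k} + m)
    (hw : w.cycleType = {2 * k} + m) (u₀ u : Equiv.Perm {x // p x}) :
    conjugators (ofSubtype u₀ * ofSubtype v) (ofSubtype u * ofSubtype w) = 0 := by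
  rw [conjugators_eq, if_neg]
  intro h
  have hc := congrArg (Multiset.count k) h
  rw [cycleType_ofSubtype_mul, cycleType_ofSubtype_mul, hv, hw] at hc
  simp only [Multiset.count_add, Multiset.insert_eq_cons, Multiset.count_cons_self,
    Multiset.count_singleton_self, Multiset.count_singleton] at hc
  rw [if_neg (by omega)] at hc
  have hle : Multiset.replicate 2 k ≤ u.cycleType :=
    Multiset.le_count_iff_replicate_le.mp (by omega)
  obtain ⟨t, ht⟩ := Multiset.le_iff_exists_add.mp hle
  have hs := congrArg Multiset.sum ht
  rw [sum_cycleType, Multiset.sum_add, Multiset.sum_replicate, smul_eq_mul] at hs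
  have := Finset.card_le_univ u.support
  omega

theorem blockFunction_apply_merge {k : ℕ} {m : Multiset ℕ} (hk : 2 ≤ k)
    (hbk : Fintype.card {x // p x} ≤ k) (hv : v.cycleType = {k, k} + m)
    (hw : w.cycleType = {2 * k} + m) (hvb : ∀ c ∈ v.cycleType, Fintype.card {x // p x} ≤ c)
    (he : v.supportᶜ.card ≤ 1) (u₀ : Equiv.Perm {x // p x}) :
    blockFunction p v w (ofSubtype u₀ * ofSubtype v) = centralizerRatio p u₀ v / 2 := by
  have h1 : ∑ u' : Equiv.Perm {x // p x}, (conjugators (ofSubtype u₀ * ofSubtype v)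
      (ofSubtype u' * ofSubtype v) : ℝ) =
      Nat.card (Equiv.Perm {x // p x}) * centralizerRatio p u₀ v := by
    exact_mod_cast sum_conjugators_ofSubtype p u₀ v hvb he
  rw [blockFunction, h1, Finset.sum_eq_zero (fun u _ => by
    rw [conjugators_merge_eq_zero p hk hbk hv hw, Nat.cast_zero])]
  have : (Nat.card (Equiv.Perm {x // p x}) : ℝ) ≠ 0 := Nat.cast_ne_zero.mpr Nat.card_pos.ne'
  field_simp
  ring

theorem centralizerRatio_eq (u : Equiv.Perm {x // p x}) :
    centralizerRatio p u w = centralizerOrder w * ((1 + w.supportᶜ.card * u.supportᶜ.card) +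
      w.cycleType.count (Fintype.card {x // p x}) *
        if u.cycleType = {Fintype.card {x // p x}} then 1 else 0) := by
  rw [centralizerRatio, mul_assoc]
  congr 1
  split_ifs with hu
  · rw [card_compl_support_of_cycleType_eq_singleton hu, Nat.sub_self]
    ring
  · ring

/-- Bound for the sum of the centralizer ratios over the permutations of the block that have a
given sign. -/
theorem two_mul_sum_centralizerRatio_le (hb : 2 ≤ Fintype.card {x // p x})
    (he : w.supportᶜ.card = 0 ∨ (w.supportᶜ.card = 1 ∧ 3 ≤ Fintype.card {x // p x})) (ε : ℤˣ) :
    2 * (∑ u ∈ Finset.univ.filter (fun u : Equiv.Perm {x // p x} => sign u = ε),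
      centralizerRatio p u w) * Fintype.card {x // p x} ≤
      centralizerOrder w * (Nat.card (Equiv.Perm {x // p x}) *
        ((1 + w.supportᶜ.card) * Fintype.card {x // p x} +
          2 * w.cycleType.count (Fintype.card {x // p x}))) := by
  have h1 : ∑ u ∈ Finset.univ.filter (fun u : Equiv.Perm {x // p x} => sign u = ε),
      centralizerRatio p u w ≤ centralizerOrder w *
        (∑ u ∈ Finset.univ.filter (fun u : Equiv.Perm {x // p x} => sign u = ε),
          (1 + w.supportᶜ.card * u.supportᶜ.card) +
          w.cycleType.count (Fintype.card {x // p x}) * (Finset.univ.filter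
            (fun u : Equiv.Perm {x // p x} => u.cycleType = {Fintype.card {x // p x}})).card) := by
    rw [Finset.sum_congr rfl fun u _ => centralizerRatio_eq p u, ← Finset.mul_sum,
      Finset.sum_add_distrib, ← Finset.mul_sum, Finset.card_filter]
    -- The full cycles of the block are counted whatever their sign, which is enough for an upper
    -- bound.
    exact Nat.mul_le_mul_left _ (Nat.add_le_add_left (Nat.mul_le_mul_left _
      (Finset.sum_le_sum_of_subset (Finset.filter_subset _ _))) _)
  have h2 := two_mul_sum_sign_one_add hb he ε
  have h3 := card_cycleType_eq_card_mul hb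
  refine (Nat.mul_le_mul_right _ (Nat.mul_le_mul_left 2 h1)).trans_eq ?_
  rw [mul_left_comm 2, mul_add 2, h2, ← h3]
  ring

/-- The hypothesis on full cycles removes the correction term, making the sum exact. The final
estimate depends on this, since this half must be no larger than half of the value at g. -/
theorem two_mul_sum_centralizerRatio_eq (hb : 2 ≤ Fintype.card {x // p x})
    (he : v.supportᶜ.card = 0 ∨ (v.supportᶜ.card = 1 ∧ 3 ≤ Fintype.card {x // p x})) {ε : ℤˣ}
    (h : ∀ u : Equiv.Perm {x // p x}, sign u = ε → u.cycleType = {Fintype.card {x // p x}} →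
      v.cycleType.count (Fintype.card {x // p x}) = 0) :
    2 * (∑ u ∈ Finset.univ.filter (fun u : Equiv.Perm {x // p x} => sign u = ε),
      centralizerRatio p u v) =
      Nat.card (Equiv.Perm {x // p x}) * (centralizerOrder v * (1 + v.supportᶜ.card)) := by
  rw [mul_left_comm, ← two_mul_sum_sign_one_add hb he ε, mul_left_comm]
  congr 1
  rw [Finset.mul_sum]
  refine Finset.sum_congr rfl fun u hu => ?_
  rw [centralizerRatio_eq p]
  split_ifs with hub
  · rw [h u (Finset.mem_filter.mp hu).2 hub, zero_mul, add_zero]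
  · rw [mul_zero, add_zero]

/-- At uv the subtracted w-term is dropped, and at uw the v-term; both are nonnegative. -/
theorem charForm_blockFunction_le [Nontrivial α]
    (hv : ∀ c ∈ v.cycleType, Fintype.card {x // p x} ≤ c)
    (he : v.supportᶜ.card ≤ 1) (hw : ∀ c ∈ w.cycleType, Fintype.card {x // p x} ≤ c)
    (he' : w.supportᶜ.card ≤ 1) {n : ℝ}
    (hn : charForm (fun h : alternatingGroup α => (blockFunction p v w h : ℂ))
      (fun h : alternatingGroup α => (blockFunction p v w h : ℂ)) = n) :
    Nat.card (Equiv.Perm {x // p x}) * (2 * n) ≤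
      (∑ u ∈ Finset.univ.filter (fun u : Equiv.Perm {x // p x} => sign u = sign v),
        centralizerRatio p u v +
      ∑ u ∈ Finset.univ.filter (fun u : Equiv.Perm {x // p x} => sign u = sign w),
        centralizerRatio p u w : ℕ) := by
  rw [charForm_blockFunction] at hn
  rw [← Complex.ofReal_injective hn, mul_left_comm, mul_inv_cancel_left₀
    (Nat.cast_ne_zero.mpr Nat.card_pos.ne'), ← Finset.sum_filter, ← Finset.sum_filter]
  have h1 := Finset.sum_le_sum fun u (_ : u ∈ Finset.univ.filter
    (fun u : Equiv.Perm {x // p x} => sign u = sign v)) => blockFunction_le p (w := w) hv he u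
  have h2 := Finset.sum_le_sum fun u (_ : u ∈ Finset.univ.filter
    (fun u : Equiv.Perm {x // p x} => sign u = sign w)) => neg_le_blockFunction p (v := v) hw he' u
  rw [Finset.sum_neg_distrib, ← Finset.sum_div] at h2
  rw [← Finset.sum_div] at h1
  push_cast
  linarith

end BlockBounds

/-! ### The inequality forced by a repeated part -/

section BlockInequality

open Equiv.Perm Nat

variable {α : Type} [Fintype α] [DecidableEq α]

theorem cancel_block_inequality {K T A D S R q b e N M : ℕ} (hK : 0 < K) (hT : 0 < T)
    (hM : M = T * A) (hN : N = T * D) (hS : 2 * S = K * (M * (1 + e)))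
    (hR : 2 * R * b ≤ N * (K * ((1 + e) * b + 2 * q))) (h : K * (M * (1 + e)) ≤ S + R) :
    A * b ≤ D * (b + 2 * q) := by
  have h1 : K * (M * (1 + e)) * b ≤ 2 * R * b := Nat.mul_le_mul_right b (by omega)
  have h2 : (1 + e) * b + 2 * q ≤ (1 + e) * (b + 2 * q) := by
    rw [mul_add]
    exact Nat.add_le_add_left (Nat.le_mul_of_pos_left _ (by omega)) _
  have h3 : (K * T * (1 + e)) * (A * b) ≤ (K * T * (1 + e)) * (D * (b + 2 * q)) := by
    calc (K * T * (1 + e)) * (A * b) = K * (M * (1 + e)) * b := by rw [hM]; ring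
      _ ≤ N * (K * ((1 + e) * b + 2 * q)) := h1.trans hR
      _ ≤ N * (K * ((1 + e) * (b + 2 * q))) :=
          Nat.mul_le_mul_left _ (Nat.mul_le_mul_left _ h2)
      _ = _ := by rw [hN]; ring
  exact Nat.le_of_mul_le_mul_left h3 (by positivity)

theorem exists_merge {β : Type} [Fintype β] [DecidableEq β] {v : Equiv.Perm β} {k : ℕ}
    (hk : 2 ≤ k) {m : Multiset ℕ} (hv : v.cycleType = {k, k} + m) :
    ∃ w : Equiv.Perm β, w.cycleType = {2 * k} + m ∧ w.supportᶜ.card = v.supportᶜ.card := by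
  have hsumv : v.cycleType.sum = 2 * k + m.sum := by
    rw [hv]
    simp only [Multiset.sum_add, Multiset.insert_eq_cons, Multiset.sum_cons,
      Multiset.sum_singleton]
    ring
  obtain ⟨w, hw⟩ : ∃ w : Equiv.Perm β, w.cycleType = {2 * k} + m := by
    refine (exists_with_cycleType_iff _).mpr ⟨?_, ?_⟩
    · rw [Multiset.sum_add, Multiset.sum_singleton, ← hsumv, sum_cycleType]
      exact Finset.card_le_univ _
    · intro a ha
      rcases Multiset.mem_add.mp ha with h | h
      · rw [Multiset.mem_singleton] at h
        omega
      · exact two_le_of_mem_cycleType (σ := v) (by rw [hv]; exact Multiset.mem_add.mpr (Or.inr h))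
  refine ⟨w, hw, ?_⟩
  rw [Finset.card_compl, Finset.card_compl, ← sum_cycleType, ← sum_cycleType, hsumv, hw,
    Multiset.sum_add, Multiset.sum_singleton]

/-- This keeps full cycles of the block out of the v-sum when u₀ is a (b − 1)-cycle. -/
theorem sign_ne_of_cycleType_singleton {β : Type} [Fintype β] [DecidableEq β]
    {u u' : Equiv.Perm β} {b : ℕ} (hb : 1 ≤ b) (hu : u.cycleType = {b})
    (hu' : u'.cycleType = {b - 1}) : sign u ≠ sign u' := by
  intro h
  rw [sign_of_cycleType, sign_of_cycleType, hu, hu'] at h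
  simp only [Multiset.sum_singleton, Multiset.card_singleton,
    show b - 1 + 1 = b by omega, pow_succ] at h
  rcases Int.units_eq_one_or ((-1 : ℤˣ) ^ b) with h' | h' <;> rw [h'] at h <;>
    exact absurd h (by decide)

/-- With e the number of fixed points of v, the value at g is |C(v)|(1 + e)/2. The v-sum contributes
exactly half of that to the bound for the norm, so the w-sum must supply the other half. Clearing
common factors gives the inequality. -/
theorem IsSignConjClass.block_inequality {C : ConjClasses (alternatingGroup α)}
    (hC : IsSignConjClass C) {g : alternatingGroup α} (hg : g ∈ C.carrier) (p : α → Prop)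
    [DecidablePred p] {u₀ : Equiv.Perm {x // p x}} {v : Equiv.Perm {x // ¬ p x}}
    (hgv : (g : Equiv.Perm α) = ofSubtype u₀ * ofSubtype v) {k : ℕ} (hk : 2 ≤ k) {m : Multiset ℕ}
    (hv : v.cycleType = {k, k} + m) {b : ℕ} (hb : Fintype.card {x // p x} = b) (hb2 : 2 ≤ b)
    (hbk : b ≤ k) (hvb : ∀ c ∈ v.cycleType, b ≤ c) (he : v.supportᶜ.card ≤ 1)
    (h₀ : (v.cycleType.count b = 0 ∧ v.supportᶜ.card = 0 ∧ u₀.cycleType = {b}) ∨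
      (u₀.cycleType = {b - 1} ∧ 3 ≤ b)) :
    k * (m.count k + 1) * (m.count k + 2) * b ≤
      2 * (m.count (2 * k) + 1) * (b + 2 * m.count b) := by
  subst hb
  obtain ⟨w, hw, hfix⟩ := exists_merge hk hv
  have hwb : ∀ c ∈ w.cycleType, Fintype.card {x // p x} ≤ c := by
    intro c hc
    rw [hw] at hc
    rcases Multiset.mem_add.mp hc with h | h
    · rw [Multiset.mem_singleton] at h
      omega
    · exact hvb c (by rw [hv]; exact Multiset.mem_add.mpr (Or.inr h))
  have hcountw : w.cycleType.count (Fintype.card {x // p x}) =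
      m.count (Fintype.card {x // p x}) := by
    rw [hw, Multiset.count_add, Multiset.count_singleton, if_neg (by omega), zero_add]
  have hcase : v.supportᶜ.card = 0 ∨ (v.supportᶜ.card = 1 ∧ 3 ≤ Fintype.card {x // p x}) := by
    rcases h₀ with ⟨-, h2, -⟩ | ⟨-, h2⟩
    · exact Or.inl h2
    · omega
  obtain ⟨T, hTv, hTw⟩ := centralizerOrder_merge hv hw
  have hT : 0 < T := by
    have := centralizerOrder_pos v
    rw [hTv] at this
    exact Nat.pos_of_mul_pos_right this
  have hnt : Nontrivial α := by
    rw [← Fintype.one_lt_card_iff_nontrivial]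
    have := Fintype.card_subtype_le p
    omega
  have hratio : centralizerRatio p u₀ v = centralizerOrder v * (1 + v.supportᶜ.card) := by
    rw [centralizerRatio]
    rcases h₀ with ⟨h1, h2, h3⟩ | ⟨h1, h2⟩
    · rw [if_pos h3, h1, h2]
      simp
    · rw [if_neg, card_compl_support_of_cycleType_eq_singleton h1,
        show Fintype.card {x // p x} - (Fintype.card {x // p x} - 1) = 1 by omega]
      · ring
      · rw [h1, Multiset.singleton_inj]
        omega
  have hsigng : sign u₀ = sign v := by
    have h := mem_alternatingGroup.mp g.2
    rw [hgv, Equiv.Perm.sign_mul, sign_ofSubtype, sign_ofSubtype] at h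
    rw [mul_eq_one_iff_eq_inv, Int.units_inv_eq_self] at h
    exact h
  have hS := two_mul_sum_centralizerRatio_eq p hb2 hcase (v := v) (ε := sign v) fun u hu hub => by
    rcases h₀ with ⟨h1, -, -⟩ | ⟨h1, h2⟩
    · exact h1
    · exact absurd (hu.trans hsigng.symm) (sign_ne_of_cycleType_singleton (by omega) hub h1)
  have hR := two_mul_sum_centralizerRatio_le p hb2 (by rwa [hfix]) (sign w)
  rw [hfix, hcountw] at hR
  refine cancel_block_inequality Nat.card_pos hT hTv hTw hS hR ?_
  obtain ⟨a, n, ha, hn, han⟩ := hC.abs_le_charForm hg (virtualCharacters_restrict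
    (blockFunction_mem_virtualCharacters p hk hv hw) (alternatingGroup α))
  have ha' : blockFunction p v w g = a := by exact_mod_cast ha
  rw [hgv, blockFunction_apply_merge p hk hbk hv hw hvb he, hratio] at ha'
  have h1 := charForm_blockFunction_le p hvb he hwb (by rwa [hfix])
    (hn.trans (Complex.ofReal_intCast n).symm)
  have h2 : (a : ℝ) ≤ n := by exact_mod_cast (le_abs_self a).trans han
  have h3 : (Nat.card (Equiv.Perm {x // p x}) : ℝ) *
      ((centralizerOrder v * (1 + v.supportᶜ.card) : ℕ) : ℝ) ≤
      Nat.card (Equiv.Perm {x // p x}) * (2 * n) :=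
    mul_le_mul_of_nonneg_left (by linarith) (Nat.cast_nonneg _)
  exact_mod_cast h3.trans h1

end BlockInequality

/-! ### A unique shortest cycle excludes all repetitions -/

section UniqueShortestCycle

open Equiv.Perm

variable {α : Type} [Fintype α] [DecidableEq α]

/-- Take the largest k admissible in the last clause: if 2k were at least as frequent, it would be a
larger admissible part. -/
theorem exists_count_two_mul_lt {M : Multiset ℕ} {k₀ : ℕ} (h0 : 0 < k₀) (hk₀ : k₀ ∈ M) :
    ∃ k, M.count (2 * k) < M.count k ∧ (k = k₀ ∨ (2 * k₀ ≤ k ∧ M.count k₀ ≤ M.count k)) := by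
  let s := M.toFinset.filter fun k => k = k₀ ∨ (2 * k₀ ≤ k ∧ M.count k₀ ≤ M.count k)
  have hs : s.Nonempty := ⟨k₀, by simp [s, hk₀]⟩
  obtain ⟨k, hk, hmax⟩ := s.exists_max_image id hs
  simp only [s, Finset.mem_filter, Multiset.mem_toFinset, id] at hk hmax
  have hpos := Multiset.count_pos.mpr hk.1
  refine ⟨k, ?_, hk.2⟩
  by_contra! hle
  have := hmax (2 * k) ⟨Multiset.count_pos.mp (hpos.trans_le hle), Or.inr ?_⟩
  · omega
  · rcases hk.2 with rfl | ⟨h1, h2⟩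
    · exact ⟨le_rfl, hle⟩
    · exact ⟨by omega, h2.trans hle⟩

theorem not_block_inequality {k b c d q : ℕ} (hb : 2 ≤ b) (hd : d < c + 2)
    (h : (b = k ∧ 3 ≤ b ∧ q = c) ∨ (q = 0 ∧ 3 ≤ k) ∨ (3 ≤ b ∧ 2 * b ≤ k ∧ q ≤ c + 2) ∨
      (3 ≤ b ∧ b < k ∧ q ≤ 1)) :
    ¬ k * (c + 1) * (c + 2) * b ≤ 2 * (d + 1) * (b + 2 * q) := by
  intro hle
  -- Since d + 1 ≤ c + 2, the factor c + 2 cancels.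
  have h1 : k * (c + 1) * b ≤ 2 * (b + 2 * q) := by
    refine Nat.le_of_mul_le_mul_left ?_ (show 0 < c + 2 by omega)
    calc (c + 2) * (k * (c + 1) * b) = k * (c + 1) * (c + 2) * b := by ring
      _ ≤ 2 * (d + 1) * (b + 2 * q) := hle
      _ ≤ 2 * (c + 2) * (b + 2 * q) := Nat.mul_le_mul_right _ (by omega)
      _ = _ := by ring
  have h2 : ∀ K B, K ≤ k → B ≤ b → K * B * (c + 1) ≤ 2 * (b + 2 * q) := fun K B hK hB =>
    (by rw [mul_right_comm] : K * B * (c + 1) = K * (c + 1) * B).trans_le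
      ((Nat.mul_le_mul (Nat.mul_le_mul_right _ hK) hB).trans h1)
  have h3 : ∀ K, K ≤ k → K * b + K * b * c ≤ 2 * (b + 2 * q) := fun K hK => by
    have := h2 K b hK le_rfl
    linarith
  rcases h with ⟨rfl, hb3, rfl⟩ | ⟨rfl, hk⟩ | ⟨hb3, hk, hq⟩ | ⟨hb3, hk, hq⟩
  · have := h3 3 hb3
    have : 3 * q ≤ b * q := Nat.mul_le_mul_right _ hb3
    linarith
  · have := h3 3 hk
    have : 0 ≤ b * c := Nat.zero_le _
    linarith
  · have := h3 6 (by omega)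
    have : 3 * c ≤ b * c := Nat.mul_le_mul_right _ hb3
    linarith
  · have := h3 4 (by omega)
    have : 0 ≤ b * c := Nat.zero_le _
    linarith

theorem IsSignConjClass.count_le_one_of_block {C : ConjClasses (alternatingGroup α)}
    (hC : IsSignConjClass C) {g : alternatingGroup α} (hg : g ∈ C.carrier) (p : α → Prop)
    [DecidablePred p] {u₀ : Equiv.Perm {x // p x}} {v : Equiv.Perm {x // ¬ p x}}
    (hgv : (g : Equiv.Perm α) = ofSubtype u₀ * ofSubtype v)
    {b : ℕ} (hb : Fintype.card {x // p x} = b) (hb2 : 2 ≤ b)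
    (hvb : ∀ c ∈ v.cycleType, b ≤ c) (he : v.supportᶜ.card ≤ 1)
    (h₀ : (v.cycleType.count b = 0 ∧ v.supportᶜ.card = 0 ∧ u₀.cycleType = {b}) ∨
      (u₀.cycleType = {b - 1} ∧ 3 ≤ b)) (k₀ : ℕ) : v.cycleType.count k₀ ≤ 1 := by
  by_contra! hk₀
  -- Starting from b itself whenever b is repeated keeps q under control: q is c, at most c + 2, or
  -- at most 1. If b = 2, the first alternative of `h₀` gives q = 0.
  obtain ⟨k₁, hk₁, hk₁b⟩ : ∃ k₁, 2 ≤ v.cycleType.count k₁ ∧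
      (k₁ = b ∨ v.cycleType.count b ≤ 1) := by
    by_cases h : 2 ≤ v.cycleType.count b
    · exact ⟨b, h, Or.inl rfl⟩
    · exact ⟨k₀, hk₀, Or.inr (by omega)⟩
  have hmem : k₁ ∈ v.cycleType := Multiset.count_pos.mp (by omega)
  have hbk₁ := hvb k₁ hmem
  obtain ⟨k, hk, hkk⟩ := exists_count_two_mul_lt (by omega) hmem
  have hk2 : 2 ≤ v.cycleType.count k := by
    rcases hkk with rfl | ⟨-, h⟩ <;> omega
  have hbk : b ≤ k := by omega
  obtain ⟨m, hm⟩ := Multiset.le_iff_exists_add.mp (Multiset.le_count_iff_replicate_le.mp hk2)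
  have hm' : v.cycleType = {k, k} + m := hm
  have hcount : ∀ j, v.cycleType.count j = (if j = k then 2 else 0) + m.count j := by
    intro j
    rw [hm, Multiset.count_add, Multiset.count_replicate]
    simp only [eq_comm]
  have hck := hcount k
  have hc2k := hcount (2 * k)
  have hcb := hcount b
  rw [if_pos rfl] at hck
  rw [if_neg (by omega)] at hc2k
  refine not_block_inequality hb2 (c := m.count k) (d := m.count (2 * k)) (by omega) ?_
    (hC.block_inequality hg p hgv (by omega) hm' hb hb2 hbk hvb he h₀)
  by_cases hbk' : b = k
  · rw [if_pos hbk'] at hcb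
    refine Or.inl ⟨hbk', ?_, by rw [hbk']⟩
    omega
  · rw [if_neg hbk'] at hcb
    rcases hk₁b with rfl | h <;> omega

/-- The block is the support of one l-cycle together with the fixed points in s. -/
theorem exists_block (σ : Equiv.Perm α) {l : ℕ} (hl : l ∈ σ.cycleType) {s : Finset α}
    (hs : s ⊆ σ.supportᶜ) : ∃ (p : α → Prop) (_ : DecidablePred p)
      (u : Equiv.Perm {x // p x}) (v : Equiv.Perm {x // ¬ p x}),
      Fintype.card {x // p x} = l + s.card ∧
      σ = ofSubtype u * ofSubtype v ∧ u.cycleType = {l} ∧ σ.cycleType = {l} + v.cycleType ∧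
      σ.supportᶜ.card = s.card + v.supportᶜ.card := by
  obtain ⟨c, τ, rfl, hd, hc, rfl⟩ := mem_cycleType_iff.mp hl
  have hsup : ∀ x ∈ s, c x = x ∧ τ x = x := by
    intro x hx
    have := hs hx
    rw [hd.support_mul, Finset.mem_compl, Finset.mem_union, not_or, notMem_support,
      notMem_support] at this
    exact this
  obtain ⟨p, _, hp⟩ : ∃ (p : α → Prop) (_ : DecidablePred p), ∀ x, p x ↔ x ∈ c.support ∪ s :=
    ⟨fun x => x ∈ c.support ∪ s, inferInstance, fun _ => Iff.rfl⟩
  have hτ : ∀ x, p x → τ x = x := by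
    intro x hx
    rcases Finset.mem_union.mp ((hp x).mp hx) with h | h
    · exact (hd x).resolve_left (mem_support.mp h)
    · exact (hsup x h).2
  have hcB : ∀ x, p (c x) ↔ p x := by
    intro x
    by_cases hx : c x = x
    · rw [hx]
    · simp only [hp, Finset.mem_union, apply_mem_support, mem_support.mpr hx, true_or]
  have hτB : ∀ x, ¬ p (τ x) ↔ ¬ p x := by
    intro x
    refine not_congr ⟨fun h => ?_, fun h => by rwa [hτ x h]⟩
    have := τ.injective (hτ _ h)
    rwa [this] at h
  have hu : ofSubtype (c.subtypePerm hcB) = c := ofSubtype_subtypePerm hcB fun x hx =>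
    (hp x).mpr (Finset.mem_union_left _ (mem_support.mpr hx))
  have hv : ofSubtype (τ.subtypePerm (p := fun x => ¬ p x) hτB) = τ :=
    ofSubtype_subtypePerm (p := fun x => ¬ p x) hτB fun x hx h => hx (hτ x h)
  have hcard : Fintype.card {x // p x} = c.support.card + s.card := by
    rw [Fintype.card_of_subtype (c.support ∪ s) fun x => (hp x).symm, Finset.card_union_of_disjoint]
    exact Finset.disjoint_left.mpr fun x hx hx' => mem_support.mp hx (hsup x hx').1
  have hcu : (c.subtypePerm hcB).cycleType = {c.support.card} := by
    rw [← cycleType_ofSubtype, hu, hc.cycleType]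
  have hσ : c * τ = ofSubtype (c.subtypePerm hcB) *
      ofSubtype (τ.subtypePerm (p := fun x => ¬ p x) hτB) := by
    rw [hu, hv]
  refine ⟨p, inferInstance, c.subtypePerm hcB, τ.subtypePerm hτB, hcard, hσ, hcu, ?_, ?_⟩
  · rw [hσ, cycleType_ofSubtype_mul, hcu]
  · rw [hσ, card_compl_support_ofSubtype_mul, card_compl_support_of_cycleType_eq_singleton hcu,
      hcard, Nat.add_sub_cancel_left]

theorem IsSignConjClass.count_le_one_of_count_min_eq_one {C : ConjClasses (alternatingGroup α)}
    (hC : IsSignConjClass C) {g : alternatingGroup α} (hg : g ∈ C.carrier) {l : ℕ}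
    (hl : (g : Equiv.Perm α).cycleType.count l = 1)
    (hmin : ∀ c ∈ (g : Equiv.Perm α).cycleType, l ≤ c)
    (hf : (g : Equiv.Perm α).supportᶜ.card ≤ 2) (k : ℕ) :
    (g : Equiv.Perm α).cycleType.count k ≤ 1 := by
  have hmem : l ∈ (g : Equiv.Perm α).cycleType := Multiset.count_pos.mp (by omega)
  have hl2 := two_le_of_mem_cycleType hmem
  -- One fixed point, if any exists, goes into the block: this leaves v at most one, and makes u₀ a
  -- (b − 1)-cycle with b = l + 1 ≥ 3. Otherwise b = l, which is not a cycle length of v.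
  obtain ⟨s, hs, hs1, hs0⟩ : ∃ s ⊆ (g : Equiv.Perm α).supportᶜ, s.card ≤ 1 ∧
      (g : Equiv.Perm α).supportᶜ.card ≤ 2 * s.card := by
    obtain h | ⟨x, hx⟩ := ((g : Equiv.Perm α).supportᶜ).eq_empty_or_nonempty
    · exact ⟨∅, Finset.empty_subset _, by simp, by simp [h]⟩
    · exact ⟨{x}, Finset.singleton_subset_iff.mpr hx, by simp, by simpa using hf⟩
  obtain ⟨p, _, u, v, hp, hg', hu, hgc, hfix⟩ := exists_block _ hmem hs
  have hlv : v.cycleType.count l = 0 := by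
    rw [hgc, Multiset.count_add, Multiset.count_singleton_self] at hl
    omega
  have hvl : ∀ c ∈ v.cycleType, l + 1 ≤ c := by
    intro c hc
    refine lt_of_le_of_ne (hmin c (by rw [hgc]; exact Multiset.mem_add.mpr (Or.inr hc))) ?_
    rintro rfl
    exact Multiset.count_eq_zero.mp hlv hc
  by_cases hkl : k = l
  · rw [hkl, hl]
  rw [hgc, Multiset.count_add, Multiset.count_singleton, if_neg hkl, zero_add]
  refine hC.count_le_one_of_block hg p hg' hp (by omega)
    (fun c hc => by have := hvl c hc; omega) (by omega) ?_ k
  obtain h | h : s.card = 0 ∨ s.card = 1 := by omega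
  · rw [h, add_zero]
    exact Or.inl ⟨hlv, by omega, hu⟩
  · rw [h, Nat.add_sub_cancel]
    exact Or.inr ⟨hu, by omega⟩

end UniqueShortestCycle

/-! ### From cycle types to partitions -/

section Partition

open Equiv.Perm

variable {α : Type} [Fintype α] [DecidableEq α]

theorem count_one_partition_parts (σ : Equiv.Perm α) :
    σ.partition.parts.count 1 = σ.supportᶜ.card := by
  rw [parts_partition, Multiset.count_add, Multiset.count_replicate_self, Finset.card_compl,
    Multiset.count_eq_zero_of_notMem fun h => absurd (two_le_of_mem_cycleType h) (by decide),
    zero_add]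

theorem count_partition_parts (σ : Equiv.Perm α) {k : ℕ} (hk : k ≠ 1) :
    σ.partition.parts.count k = σ.cycleType.count k := by
  rw [parts_partition, Multiset.count_add, Multiset.count_replicate, if_neg hk.symm, add_zero]

theorem partition_parts_of_two_le_count {n : ℕ} (γ : n.Partition) (hn : n = 4 ∨ n = 5) {k : ℕ}
    (hk : k ≠ 1) (h : 2 ≤ γ.parts.count k) : γ.parts = {2, 2} ∨ γ.parts = {2, 2, 1} := by
  have hpos : 0 < k := γ.parts_pos (Multiset.count_pos.mp (by omega))
  obtain ⟨t, ht⟩ := Multiset.le_iff_exists_add.mp (Multiset.le_count_iff_replicate_le.mp h)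
  have hs := γ.parts_sum
  rw [ht, Multiset.sum_add, Multiset.sum_replicate, smul_eq_mul] at hs
  have hk2 : k = 2 := by omega
  subst hk2
  have htpos : ∀ i ∈ t, 0 < i := fun i hi =>
    γ.parts_pos (by rw [ht]; exact Multiset.mem_add.mpr (Or.inr hi))
  rcases t.empty_or_exists_mem with rfl | ⟨i, hi⟩
  · exact Or.inl ht
  · obtain ⟨t', rfl⟩ := Multiset.exists_cons_of_mem hi
    have hi0 := htpos i hi
    rw [Multiset.sum_cons] at hs
    have hi1 : i = 1 := by omega
    rcases t'.empty_or_exists_mem with rfl | ⟨j, hj⟩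
    · right
      rw [ht, hi1]
      rfl
    · have := htpos j (Multiset.mem_cons_of_mem hj)
      have := Multiset.le_sum_of_mem hj
      omega

theorem IsSignConjClass.count_cycleType_le_one {C : ConjClasses (alternatingGroup α)}
    (hC : IsSignConjClass C) {g : alternatingGroup α} (hg : g ∈ C.carrier)
    (hf : (g : Equiv.Perm α).supportᶜ.card ≤ 2) (h4 : Fintype.card α ≠ 4)
    (h5 : Fintype.card α ≠ 5) (k : ℕ) : (g : Equiv.Perm α).cycleType.count k ≤ 1 := by
  rcases (g : Equiv.Perm α).cycleType.empty_or_exists_mem with h | ⟨c, hc⟩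
  · rw [h]
    simp
  · obtain ⟨l, hl, hmin⟩ := (g : Equiv.Perm α).cycleType.toFinset.exists_min_image id
      ⟨c, Multiset.mem_toFinset.mpr hc⟩
    simp only [Multiset.mem_toFinset, id] at hl hmin
    have h1 := hC.count_le_one_of_forall_le hg (two_le_of_mem_cycleType hl) hmin hf h4 h5
    have h2 := Multiset.count_pos.mpr hl
    exact hC.count_le_one_of_count_min_eq_one hg (by omega) hmin hf k

end Partition

theorem lemma1p4 (n : ℕ) (γ : n.Partition) (hγ : IsAlternatingSignPartition γ)
    (h111 : γ.parts ≠ {1, 1, 1}) (h22 : γ.parts ≠ {2, 2}) (h221 : γ.parts ≠ {2, 2, 1}) :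
    (∀ k : ℕ, k ≠ 1 → γ.parts.count k ≤ 1) ∧ γ.parts.count 1 ≤ 2 := by
  obtain ⟨C, hC, g, hg, hparts⟩ := hγ
  have h1 : γ.parts.count 1 ≤ 2 := by
    by_contra! h3
    rcases le_or_gt 4 n with hn | hn
    · have := hC.card_fixed_le_two hg (by simpa using hn)
      rw [← hparts, count_one_partition_parts] at h3
      omega
    -- For n < 4, three parts 1 already exhaust n.
    · obtain ⟨t, ht⟩ := Multiset.le_iff_exists_add.mp (Multiset.le_count_iff_replicate_le.mp h3)
      have hs := γ.parts_sum
      rw [ht, Multiset.sum_add, Multiset.sum_replicate, smul_eq_mul] at hs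
      rcases t.empty_or_exists_mem with rfl | ⟨i, hi⟩
      · exact h111 ht
      · have := γ.parts_pos (i := i) (by rw [ht]; exact Multiset.mem_add.mpr (Or.inr hi))
        have := Multiset.le_sum_of_mem hi
        omega
  refine ⟨fun k hk => ?_, h1⟩
  -- For these n a repeated part other than 1 leaves only the excluded partitions (2,2) and (2,2,1).
  by_cases hn : n = 4 ∨ n = 5
  · by_contra! h2
    rcases partition_parts_of_two_le_count γ hn hk h2 with h | h
    · exact h22 h
    · exact h221 h
  · rw [not_or] at hn
    rw [← hparts, count_one_partition_parts] at h1
    rw [← hparts, count_partition_parts _ hk]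
    exact hC.count_cycleType_le_one hg h1 (by simpa using hn.1) (by simpa using hn.2) k
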